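/- Work on the rectangular board $F$ with columns $1,\dots,p$ and rows $1,\dots,q$; square $(i,j)$ lies in the $i$th column from the left and the $j$th row from the bottom. A placement on $F$ is a set $P\subseteq F$ with at most one square (marker) in each row and in each column. Its insertion tableau $\mathrm{ins}(P)$ is the tableau obtained by Robinson--Schensted row insertion of the row numbers of the markers of $P$, read in order of increasing column. Let $a<b$ be columns of $F$. A decreasing (increasing) sequence of $P$ between columns $a$ and $b$ is a sequence $S=S_1\dots S_k$ of markers of $P$ in columns from $a$ to $b$ inclusive, with increasing column numbers and decreasing (increasing) row numbers. Sequences are compared lexicographically by their row numbers, read from left to right. Let $\mathbf d$ and $\mathbf D$ be the lexicographically smallest and largest decreasing sequences of maximal length between columns $a$ and $b$, and let $\mathbf i$ and $\mathbf I$ be the lexicographically smallest and largest increasing sequences of maximal length between columns $a$ and $b$. If $P$ has no marker in column $c$ and $S=S_1\dots S_k$ lies to the right of column $c$, let $P(c\leftarrow S)$ be obtained from $P$ by moving, within their rows, the marker $S_1$ to column $c$ and each $S_i$ with $1<i\le k$ to the former column of $S_{i-1}$. If $P$ has no marker in column $c$ and $S$ lies to the left of column $c$, let $P(S\rightarrow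 c)$ be obtained from $P$ by moving, within their rows, $S_k$ to column $c$ and each $S_i$ with $1\le i<k$ to the former column of $S_{i+1}$. (If $S$ is empty, nothing moves.) A generalized Knuth transformation replaces $P$, for some columns $a<b$ of $F$, by $P(a\leftarrow\mathbf d)$ or $P(a\leftarrow\mathbf I)$ if $P$ has no marker in column $a$, or by $P(\mathbf D\rightarrow b)$ or $P(\mathbf i\rightarrow b)$ if $P$ has no marker in column $b$. Theorem. If two placements $P$ and $Q$ on $F$ differ by generalized Knuth transformations, that is, if $Q$ can be reached from $P$ by a finite sequence of generalized Knuth transformations and inverses of such transformations, then $\mathrm{ins}(P)=\mathrm{ins}(Q)$. -/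

import Mathlib

namespace GenKnuth

/-- A square `(i, j)` is the square in column `i` (from the left) and row `j` (from the bottom). -/
abbrev Square := ℕ × ℕ

/-- The rectangular Ferrers board with columns `1, …, p` and rows `1, …, q`. -/
def rectBoard (p q : ℕ) : Finset Square := Finset.Icc 1 p ×ˢ Finset.Icc 1 q

/-- A (not necessarily full) rook placement on the board `F`. -/
structure RookPlacement (F : Finset Square) where
  squares : Finset Square
  subset : squares ⊆ F
  col_inj : ∀ s ∈ squares, ∀ t ∈ squares, s.1 = t.1 → s = t
  row_inj : ∀ s ∈ squares, ∀ t ∈ squares, s.2 = t.2 → s = t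

/-! ### Robinson–Schensted insertion -/

/-- Insert `x` in a row: `x` replaces the leftmost entry larger than `x`, which is bumped and
returned; if there is none, `x` is put at the right end and nothing is bumped. -/
def rowInsert (x : ℕ) : List ℕ → List ℕ × Option ℕ
  | [] => ([x], none)
  | y :: ys =>
    if x < y then (x :: ys, some y)
    else (y :: (rowInsert x ys).1, (rowInsert x ys).2)

/-- Insert `x` in a tableau, given as the list of its rows from top to bottom: insert `x` in the
top row, the bumped entry in the second row, and so on. -/
def tableauInsert : List (List ℕ) → ℕ → List (List ℕ)
  | [], x => [[x]]
  | r :: rs, x =>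
    match rowInsert x r with
    | (r', none) => r' :: rs
    | (r', some y) => r' :: tableauInsert rs y

/-- The values `j₁, …, j_m` of the partial permutation of a placement, listed by increasing
column: the lower line of its two-line notation. -/
def word (P : Finset Square) : List ℕ :=
  ((P.map toLex.toEmbedding).sort (· ≤ ·)).map fun s => (ofLex s).2

/-- The insertion tableau of a placement (list of rows, from top to bottom). -/
def ins (P : Finset Square) : List (List ℕ) :=
  (word P).foldl tableauInsert []

/-! ### Longest decreasing and increasing sequences between two columns -/

/-- `S` is a decreasing sequence in the part of `P` lying in the columns `a, …, b`; its members
are listed from left to right. -/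
def IsDecSeq (P : Finset Square) (a b : ℕ) (S : List Square) : Prop :=
  (∀ s ∈ S, s ∈ P ∧ a ≤ s.1 ∧ s.1 ≤ b) ∧ S.Pairwise fun s t => s.1 < t.1 ∧ t.2 < s.2

/-- `S` is an increasing sequence in the part of `P` lying in the columns `a, …, b`; its members
are listed from left to right. -/
def IsIncSeq (P : Finset Square) (a b : ℕ) (S : List Square) : Prop :=
  (∀ s ∈ S, s ∈ P ∧ a ≤ s.1 ∧ s.1 ≤ b) ∧ S.Pairwise fun s t => s.1 < t.1 ∧ s.2 < t.2

/-- `S` has maximal length among the sequences with the property `C`. -/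
def IsLongest (C : List Square → Prop) (S : List Square) : Prop :=
  C S ∧ ∀ T, C T → T.length ≤ S.length

/-- `S` is lexicographically smallest, by its values (rows) read from left to right, among the
longest sequences with the property `C`. -/
def IsSmallestLongest (C : List Square → Prop) (S : List Square) : Prop :=
  IsLongest C S ∧ ∀ T, IsLongest C T → S.map Prod.snd ≤ T.map Prod.snd

/-- `S` is lexicographically largest, by its values (rows) read from left to right, among the
longest sequences with the property `C`. -/
def IsLargestLongest (C : List Square → Prop) (S : List Square) : Prop :=
  IsLongest C S ∧ ∀ T, IsLongest C T → T.map Prod.snd ≤ S.map Prod.snd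

/-! ### Shifts -/

/-- `P(c ← S)` for `S = S₁ … S_k`: the marker in `S₁` moves in its row to column `c`, and the one
in `S_i`, `1 < i ≤ k`, to the column of `S_{i-1}`. (`List.zip` drops the unused last column.) -/
def leftShift (P : Finset Square) (c : ℕ) (S : List Square) : Finset Square :=
  (P \ S.toFinset) ∪ (List.zip (c :: S.map Prod.fst) (S.map Prod.snd)).toFinset

/-- `P(S → c)` for `S = S₁ … S_k`: the marker in `S_i`, `1 ≤ i < k`, moves in its row to the column
of `S_{i+1}`, and the one in `S_k` to column `c`. -/
def rightShift (P : Finset Square) (S : List Square) (c : ℕ) : Finset Square :=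
  (P \ S.toFinset) ∪ (List.zip ((S.map Prod.fst).tail ++ [c]) (S.map Prod.snd)).toFinset

/-- `P` has no marker in column `c`. -/
def EmptyColumn (P : Finset Square) (c : ℕ) : Prop := ∀ s ∈ P, s.1 ≠ c

/-- `GenKnuthStep P Q`: the placement `Q` on the rectangular board arises from `P` by one
generalized Knuth transformation, for some columns `a < b` of the board. -/
inductive GenKnuthStep {p q : ℕ} (P Q : RookPlacement (rectBoard p q)) : Prop
  | leftDec (a b : ℕ) (S : List Square) (ha : 1 ≤ a) (hab : a < b) (hb : b ≤ p)
      (hcol : EmptyColumn P.squares a)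
      (hS : IsSmallestLongest (IsDecSeq P.squares a b) S)
      (hQ : Q.squares = leftShift P.squares a S)
  | leftInc (a b : ℕ) (S : List Square) (ha : 1 ≤ a) (hab : a < b) (hb : b ≤ p)
      (hcol : EmptyColumn P.squares a)
      (hS : IsLargestLongest (IsIncSeq P.squares a b) S)
      (hQ : Q.squares = leftShift P.squares a S)
  | rightDec (a b : ℕ) (S : List Square) (ha : 1 ≤ a) (hab : a < b) (hb : b ≤ p)
      (hcol : EmptyColumn P.squares b)
      (hS : IsLargestLongest (IsDecSeq P.squares a b) S)
      (hQ : Q.squares = rightShift P.squares S b)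
  | rightInc (a b : ℕ) (S : List Square) (ha : 1 ≤ a) (hab : a < b) (hb : b ≤ p)
      (hcol : EmptyColumn P.squares b)
      (hS : IsSmallestLongest (IsIncSeq P.squares a b) S)
      (hQ : Q.squares = rightShift P.squares S b)

/-- Two placements on the same rectangular board differ by generalized Knuth transformations if
they are joined by a finite chain of such transformations and inverses of such. -/
def DifferByGenKnuth {p q : ℕ} (P Q : RookPlacement (rectBoard p q)) : Prop :=
  Relation.EqvGen GenKnuthStep P Q

end GenKnuth

/-! A transformation rearranges only the part of the word coming from columns `a` to `b`. A right
shift turns `W s₁w₁ … s_k w_k` into `W w₁s₁ … w_k s_k` (the chain is delayed), a left shift turns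
`w₁s₁ … w_k s_k W` into `s₁w₁ … s_k w_k W` (it is advanced). Complementing rows, `r ↦ q - r`, makes
decreasing sequences increasing and exchanges smallest and largest. So right shifts always delay the
smallest longest increasing chain, and left shifts always advance the largest one. Attaching the
columns outside the window and undoing the complement are harmless for Knuth equivalence; hence both
directions of Knuth's theorem are proved (`Knuth.foldl_tableauInsert`,
`knuth_of_foldl_tableauInsert_eq`).

The core is `foldl_tableauInsert_newWord`. Letters carry labels that increase along increasing
pairs; the chain has labels `0, 1, …, P`, no label exceeds `P`, and no letter between a chain letter
and the next one (or the end) has the label of that chain letter. Inserting the word and its delayed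
version side by side in the first row gives equal rows. If each bumped letter is labelled by the
index it leaves, the bumped words are either equal or, up to a common suffix, again a word and its
delayed version (`shift_closed`, `shifts_of_chainTo`). Induction down the rows finishes.

The initial labels count predecessors in longest chains, or successors counted backwards. That no
letter has a forbidden label is exactly where the lexicographic extremality of the chain enters
(`not_crossing`, `knuth_of_smallest`, `knuth_of_largest`). -/

namespace GenKnuth

/-! ### Row insertion of words -/

/-- The row obtained by inserting the letters of a word one after the other in a row. -/
def rowFold : List ℕ → List ℕ → List ℕ
  | r, [] => r
  | r, x :: w => rowFold (rowInsert x r).1 w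

/-- The letters bumped, in order, when a word is inserted in a row. -/
def bumps : List ℕ → List ℕ → List ℕ
  | _, [] => []
  | r, x :: w => (rowInsert x r).2.toList ++ bumps (rowInsert x r).1 w

theorem rowFold_append (u v : List ℕ) : ∀ r, rowFold r (u ++ v) = rowFold (rowFold r u) v := by
  induction u with
  | nil => intro r; rfl
  | cons x u ih => intro r; simp [rowFold, ih]

theorem bumps_append (u v : List ℕ) :
    ∀ r, bumps r (u ++ v) = bumps r u ++ bumps (rowFold r u) v := by
  induction u with
  | nil => intro r; rfl
  | cons x u ih => intro r; simp [rowFold, bumps, ih]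

theorem tableauInsert_cons (r : List ℕ) (rs : List (List ℕ)) (x : ℕ) :
    tableauInsert (r :: rs) x =
      (rowInsert x r).1 :: (rowInsert x r).2.toList.foldl tableauInsert rs := by
  rw [tableauInsert]
  rcases h : rowInsert x r with ⟨r', _ | y⟩ <;> simp

theorem foldl_tableauInsert_cons (w : List ℕ) : ∀ (r : List ℕ) (rs : List (List ℕ)),
    w.foldl tableauInsert (r :: rs) = rowFold r w :: (bumps r w).foldl tableauInsert rs := by
  induction w with
  | nil => intro r rs; rfl
  | cons x w ih =>
    intro r rs
    simp [tableauInsert_cons, ih, rowFold, bumps, List.foldl_append]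

theorem foldl_tableauInsert_nil {w : List ℕ} (hw : w ≠ []) :
    w.foldl tableauInsert [] = rowFold [] w :: (bumps [] w).foldl tableauInsert [] := by
  rw [← foldl_tableauInsert_cons]
  cases w with
  | nil => exact absurd rfl hw
  | cons x w => simp [tableauInsert, rowInsert]

theorem rowInsert_bump {x u : ℕ} {A : List ℕ} (B : List ℕ) (hA : ∀ a ∈ A, a ≤ x) (hu : x < u) :
    rowInsert x (A ++ u :: B) = (A ++ x :: B, some u) := by
  induction A with
  | nil => simp [rowInsert, hu]
  | cons a A ih =>
    have ha : ¬ x < a := by simpa using hA a (by simp)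
    simp [rowInsert, ha, ih fun b hb => hA b (by simp [hb])]

theorem rowInsert_end {x : ℕ} {A : List ℕ} (hA : ∀ a ∈ A, a ≤ x) :
    rowInsert x A = (A ++ [x], none) := by
  induction A with
  | nil => simp [rowInsert]
  | cons a A ih =>
    have ha : ¬ x < a := by simpa using hA a (by simp)
    simp [rowInsert, ha, ih fun b hb => hA b (by simp [hb])]

theorem exists_split {x : ℕ} {r : List ℕ} (hx : x ∉ r) :
    (∀ a ∈ r, a < x) ∨ ∃ A u B, r = A ++ u :: B ∧ (∀ a ∈ A, a < x) ∧ x < u := by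
  induction r with
  | nil => simp
  | cons a r ih =>
    have hne : x ≠ a := by rintro rfl; simp at hx
    rcases lt_or_gt_of_ne hne with h | h
    · exact Or.inr ⟨[], a, r, by simp, by simp, h⟩
    · rcases ih (by simp_all) with h' | ⟨A, u, B, rfl, hA, hu⟩
      · left; simpa [h] using h'
      · exact Or.inr ⟨a :: A, u, B, by simp, by simpa [h] using hA, hu⟩

theorem perm_rowInsert (x : ℕ) (r : List ℕ) :
    ((rowInsert x r).2.toList ++ (rowInsert x r).1).Perm (x :: r) := by
  induction r with
  | nil => simp [rowInsert]
  | cons a r ih =>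
    by_cases h : x < a
    · simpa [rowInsert, h] using List.Perm.swap x a r
    · simp only [rowInsert, h, if_false]
      exact (List.perm_middle.trans (ih.cons a)).trans (List.Perm.swap x a r)

theorem perm_bumps_rowFold (w : List ℕ) : ∀ r, (bumps r w ++ rowFold r w).Perm (w ++ r) := by
  induction w with
  | nil => intro r; simp [bumps, rowFold]
  | cons x w ih =>
    intro r
    simp only [bumps, rowFold, List.append_assoc, List.cons_append]
    have h1 := (ih (rowInsert x r).1).append_left (rowInsert x r).2.toList
    refine h1.trans ?_
    rw [← List.append_assoc]
    refine (List.perm_append_comm.append_right _).trans ?_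
    rw [List.append_assoc]
    exact ((perm_rowInsert x r).append_left w).trans List.perm_middle

theorem nodup_bumps {w : List ℕ} (hw : w.Nodup) : (bumps [] w).Nodup := by
  have h := (perm_bumps_rowFold w []).nodup_iff.2 (by simpa using hw)
  exact (List.nodup_append.1 h).1

/-- The first letter makes the row nonempty and insertion never empties it, so some letter stays
behind. This drives the induction down the rows. -/
theorem length_bumps_lt {w : List ℕ} (hw : w ≠ []) : (bumps [] w).length < w.length := by
  have h := (perm_bumps_rowFold w []).length_eq
  cases w with
  | nil => exact absurd rfl hw
  | cons x w =>
    have h' := (perm_bumps_rowFold w [x]).length_eq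
    have h2 : ∀ (w r : List ℕ), r ≠ [] → rowFold r w ≠ [] := by
      intro w
      induction w with
      | nil => intro r hr; exact hr
      | cons x w ih =>
        intro r hr
        refine ih _ ?_
        cases r with
        | nil => exact absurd rfl hr
        | cons a r => by_cases h : x < a <;> simp [rowInsert, h]
    have h3 := List.length_pos_of_ne_nil (h2 w [x] (by simp))
    simp only [bumps, rowInsert, List.length_append, List.length_cons, List.length_nil,
      Option.toList] at h h' ⊢
    omega

/-! ### Labelled words with a marked chain -/

/-- An earlier letter with smaller value has a smaller label. Letters are pairs (value, label). -/
def Mono (e f : ℕ × ℕ) : Prop := e.1 < f.1 → e.2 < f.2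

/-- The word in which each marked letter is delayed to the place of the next marked one. The first
marked letter is `y`. -/
def newWord : ℕ × ℕ → List (Bool × ℕ × ℕ) → List (ℕ × ℕ)
  | y, [] => [y]
  | y, (false, x) :: l => x :: newWord y l
  | y, (true, z) :: l => y :: newWord z l

/-- The marked letters have consecutive labels, ending in `P`, and no other letter between two
marked letters has the label of the first of them. -/
def ChainTo : ℕ × ℕ → List (Bool × ℕ × ℕ) → ℕ → Prop
  | y, [], P => P = y.2
  | y, (false, x) :: l, P => x.2 ≠ y.2 ∧ ChainTo y l P
  | y, (true, z) :: l, P => y.1 < z.1 ∧ z.2 = y.2 + 1 ∧ ChainTo z l P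

/-- The letter `e` can still be inserted in the row `r`, at an index not exceeding its label. -/
def Compat (r : List ℕ) (e : ℕ × ℕ) : Prop :=
  e.1 ∉ r ∧ ∀ i u, r[i]? = some u → u < e.1 → i < e.2

/-- The letter `e` can still be bumped from the row `r` at the index that is its label. -/
def Fut (r : List ℕ) (e : ℕ × ℕ) : Prop := ∀ u, r[e.2]? = some u → e.1 ≤ u

theorem perm_newWord : ∀ (l : List (Bool × ℕ × ℕ)) (y : ℕ × ℕ),
    (newWord y l).Perm (y :: l.map Prod.snd)
  | [], y => by simp [newWord]
  | (false, x) :: l, y => by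
    simpa [newWord] using ((perm_newWord l y).cons x).trans (List.Perm.swap y x _)
  | (true, z) :: l, y => by simpa [newWord] using perm_newWord l z

/-- The chain ascends, so `x` lies below each later marked letter and monotonicity keeps its label
below the next marked label, `y.2 + 1`. If no marked letter remains, `P = y.2` is the bound. -/
theorem label_le_of_chainTo {x : ℕ × ℕ} : ∀ (l : List (Bool × ℕ × ℕ)) {y : ℕ × ℕ} {P : ℕ},
    ChainTo y l P → x.2 ≤ P → (∀ e ∈ l.map Prod.snd, Mono x e) → x.1 < y.1 → x.2 ≤ y.2
  | [], y, P, h, hP, _, _ => by simp only [ChainTo] at h; omega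
  | (false, z) :: l, y, P, h, hP, hm, hxy =>
    label_le_of_chainTo l h.2 hP (fun e he => hm e (by simp at he ⊢; tauto)) hxy
  | (true, z) :: l, y, P, h, hP, hm, hxy => by
    have := hm z (by simp) (hxy.trans h.1)
    have := h.2.1
    omega

theorem Compat.index_le {A B : List ℕ} {e : ℕ × ℕ} (h : Compat (A ++ B) e)
    (hA : ∀ a ∈ A, a < e.1) : A.length ≤ e.2 := by
  rcases A.eq_nil_or_concat with rfl | ⟨A', a, rfl⟩
  · simp
  · have := h.2 A'.length a (by simp) (hA a (by simp))
    simp; omega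

theorem Compat.lt_of {A B : List ℕ} {e : ℕ × ℕ} {u : ℕ} (h : Compat (A ++ u :: B) e)
    (hu : e.2 ≤ A.length) : e.1 < u := by
  by_contra hlt
  have hne : e.1 ≠ u := by
    intro h0
    exact h.1 (by simp [h0])
  have := h.2 A.length u (by simp) (by omega)
  omega

/-- The only new entry `x.1` sits at an index at most the label of `x`, and `Mono x e` puts that
label below the label of `e` when `x.1 < e.1`. -/
theorem Compat.bump {A B : List ℕ} {u : ℕ} {x e : ℕ × ℕ} (hx : Compat (A ++ u :: B) x)
    (hA : ∀ a ∈ A, a < x.1) (he : Compat (A ++ u :: B) e) (hm : Mono x e) (hne : x.1 ≠ e.1) :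
    Compat (A ++ x.1 :: B) e := by
  refine ⟨?_, fun i v hv hlt => ?_⟩
  · have := he.1
    simp only [List.mem_append, List.mem_cons] at this ⊢
    tauto
  · have hle := hx.index_le hA
    rcases lt_trichotomy i A.length with h | rfl | h
    · exact he.2 i v (by rw [List.getElem?_append_left h] at hv ⊢; exact hv) hlt
    · simp at hv
      subst hv
      have := hm hlt
      omega
    · refine he.2 i v ?_ hlt
      obtain ⟨j, rfl⟩ : ∃ j, i = A.length + (j + 1) := ⟨i - A.length - 1, by omega⟩
      rw [List.getElem?_append_right (by omega), Nat.add_sub_cancel_left,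
        List.getElem?_cons_succ] at hv ⊢
      exact hv

theorem Compat.push {A : List ℕ} {x e : ℕ × ℕ} (hx : Compat A x)
    (hA : ∀ a ∈ A, a < x.1) (he : Compat A e) (hm : Mono x e) (hne : x.1 ≠ e.1) :
    Compat (A ++ [x.1]) e := by
  refine ⟨?_, fun i v hv hlt => ?_⟩
  · have := he.1
    simp only [List.mem_append, List.mem_cons]
    simp only [List.not_mem_nil, or_false]
    rintro (h | h)
    · exact this h
    · exact hne h.symm
  · have hle : A.length ≤ x.2 := Compat.index_le (B := []) (by simpa using hx) hA
    rcases lt_trichotomy i A.length with h | rfl | h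
    · exact he.2 i v (by rw [List.getElem?_append_left h] at hv; exact hv) hlt
    · simp at hv
      subst hv
      have := hm hlt
      omega
    · rw [List.getElem?_eq_none (by simp; omega)] at hv
      cases hv

/-- Entries at a fixed index only decrease under insertion, so `Fut` is inherited backwards in time.
-/
theorem Fut.of_bump {A B : List ℕ} {u x : ℕ} {e : ℕ × ℕ} (h : Fut (A ++ x :: B) e)
    (hx : x ≤ u) : Fut (A ++ u :: B) e := by
  intro v hv
  rcases lt_trichotomy e.2 A.length with h' | h' | h'
  · exact h v (by rw [List.getElem?_append_left h'] at hv ⊢; exact hv)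
  · have := h x (by simp [h'])
    rw [h'] at hv
    simp at hv
    omega
  · refine h v ?_
    obtain ⟨j, hj⟩ : ∃ j, e.2 = A.length + (j + 1) := ⟨e.2 - A.length - 1, by omega⟩
    rw [hj, List.getElem?_append_right (by omega), Nat.add_sub_cancel_left,
      List.getElem?_cons_succ] at hv ⊢
    exact hv

theorem Fut.of_push {A : List ℕ} {x : ℕ} {e : ℕ × ℕ} (h : Fut (A ++ [x]) e) : Fut A e := by
  intro v hv
  refine h v ?_
  rw [List.getElem?_append_left (List.getElem?_eq_some_iff.1 hv).1]
  exact hv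

/-- Once `u` has been replaced by `v ≤ u` at index `p`, all entries up to index `p` are at most `u`,
so a letter above `u` can later leave only from the right of `p`. -/
theorem Fut.mono {A B : List ℕ} {v p : ℕ} {u : ℕ} {f : ℕ × ℕ} (h : Fut (A ++ v :: B) f)
    (hs : (A ++ v :: B).Pairwise (· < ·)) (hp : p = A.length) (hv : v ≤ u) : Mono (u, p) f := by
  subst hp
  intro hlt
  by_contra hle
  simp only [not_lt] at hle hlt
  rcases hle.lt_or_eq with h' | h'
  · have hget : (A ++ v :: B)[f.2]? = some A[f.2] := by
      rw [List.getElem?_append_left h']; simp [h']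
    have h1 := h _ hget
    have h2 := (List.pairwise_append.1 hs).2.2 A[f.2] (by simp) v (by simp)
    omega
  · have := h v (by simp [h'])
    omega

/-- Pairs of letters, the first to the left of the second, in a labelled word. -/
def Good (e f : ℕ × ℕ) : Prop := e.1 ≠ f.1 ∧ Mono e f

/-! ### Two words inserted side by side in one row -/

theorem pairwise_bump {A B : List ℕ} {u x : ℕ} (hs : (A ++ u :: B).Pairwise (· < ·))
    (hA : ∀ a ∈ A, a < x) (hu : x < u) : (A ++ x :: B).Pairwise (· < ·) := by
  rw [List.pairwise_append, List.pairwise_cons] at hs ⊢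
  refine ⟨hs.1, ⟨fun b hb => hu.trans (hs.2.1.1 b hb), hs.2.1.2⟩, ?_⟩
  intro a ha b hb
  rcases List.mem_cons.1 hb with rfl | hb
  exacts [hA a ha, hs.2.2 a ha b (by simp [hb])]

theorem pairwise_insert {A B : List ℕ} {u x : ℕ} (hs : (A ++ u :: B).Pairwise (· < ·))
    (hA : ∀ a ∈ A, a < x) (hu : x < u) : (A ++ x :: u :: B).Pairwise (· < ·) := by
  have h := pairwise_bump hs hA hu
  rw [List.pairwise_append, List.pairwise_cons] at hs h ⊢
  refine ⟨hs.1, ⟨?_, List.pairwise_cons.2 hs.2.1⟩, ?_⟩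
  · intro b hb
    rcases List.mem_cons.1 hb with rfl | hb
    exacts [hu, hu.trans (hs.2.1.1 b hb)]
  · intro a ha b hb
    rcases List.mem_cons.1 hb with rfl | hb
    exacts [hA a ha, hs.2.2 a ha b hb]

theorem pairwise_push {A : List ℕ} {x : ℕ} (hs : A.Pairwise (· < ·))
    (hA : ∀ a ∈ A, a < x) : (A ++ [x]).Pairwise (· < ·) :=
  List.pairwise_append.2 ⟨hs, by simp, by simpa using hA⟩

/-- The rows differ only by the pending letter `y`, present in the first and still to come in the
second. The labels preserve this shape: an unmarked letter acts alike on both rows; a marked `x`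
bumps from the first row what `y` bumps from the second, if anything, and is pending afterwards. -/
theorem shift_closed : ∀ (l : List (Bool × ℕ × ℕ)) (X : List ℕ) (y : ℕ × ℕ) (N : List ℕ) (P : ℕ),
    (X ++ y.1 :: N).Pairwise (· < ·) → X.length = y.2 →
    (∀ e ∈ l.map Prod.snd, Compat (X ++ y.1 :: N) e) → (l.map Prod.snd).Pairwise Good →
    ChainTo y l P → (∀ e ∈ l.map Prod.snd, e.2 ≤ P) → (X ++ y.1 :: N).length ≤ P + 1 →
    rowFold (X ++ y.1 :: N) ((l.map Prod.snd).map Prod.fst) =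
      rowFold (X ++ N) ((newWord y l).map Prod.fst) ∧
    bumps (X ++ y.1 :: N) ((l.map Prod.snd).map Prod.fst) =
      bumps (X ++ N) ((newWord y l).map Prod.fst) := by
  intro l
  induction l with
  | nil =>
    intro X y N P hs hX _ _ hch _ hlen
    simp only [ChainTo] at hch
    -- No marked letter is left, so `P` is the index of `y`, and a row of at most `P + 1` entries
    -- ends there; the delayed word now appends `y`.
    have hN : N = [] := by
      rw [← List.length_eq_zero_iff]
      simp at hlen; omega
    subst hN
    have h1 : rowInsert y.1 X = (X ++ [y.1], none) :=
      rowInsert_end fun a ha => ((List.pairwise_append.1 hs).2.2 a ha y.1 (by simp)).le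
    simp [newWord, rowFold, bumps, h1]
  | cons e l ih =>
    intro X y N P hs hX hc hm hch hP hlen
    obtain ⟨b, x⟩ := e
    simp only [List.map_cons, List.forall_mem_cons, List.pairwise_cons] at hc hm hP
    obtain ⟨hcx, hc⟩ := hc
    obtain ⟨hmx, hm⟩ := hm
    obtain ⟨hPx, hP⟩ := hP
    have hs' := List.pairwise_append.1 hs
    have hyN := List.pairwise_cons.1 hs'.2.1
    cases b with
    | false =>
      simp only [ChainTo] at hch
      have hnot := hcx.1
      simp only [List.mem_append, List.mem_cons, not_or] at hnot
      rcases exists_split hnot.1 with hX1 | ⟨X1, u, X2, rfl, hX1, hu⟩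
      -- Otherwise `x` would replace `y`: its label is at least `X.length = y.2` by `Compat`, at
      -- most `y.2` along the chain, and `ChainTo` forbids equality.
      · have hxy : y.1 < x.1 := by
          rcases lt_or_gt_of_ne hnot.2.1 with h | h
          · have h1 := label_le_of_chainTo l hch.2 hPx (fun e he => (hmx e he).2) h
            have h2 := hcx.index_le hX1
            have := hch.1
            omega
          · exact h
        rcases exists_split hnot.2.2 with hN1 | ⟨N1, u, N2, rfl, hN1, hu⟩
        · have hall : ∀ a ∈ X ++ y.1 :: N, a < x.1 := by
            simp only [List.mem_append, List.mem_cons]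
            rintro a (h | rfl | h)
            exacts [hX1 a h, hxy, hN1 a h]
          have h1 : rowInsert x.1 (X ++ y.1 :: N) = (X ++ y.1 :: (N ++ [x.1]), none) := by
            rw [rowInsert_end fun a ha => (hall a ha).le]; simp
          have h2 : rowInsert x.1 (X ++ N) = (X ++ (N ++ [x.1]), none) := by
            rw [rowInsert_end fun a ha => (hall a (by simp at ha ⊢; tauto)).le]; simp
          have hr : X ++ y.1 :: (N ++ [x.1]) = (X ++ y.1 :: N) ++ [x.1] := by simp
          have := ih X y (N ++ [x.1]) P
            (by rw [hr]; exact pairwise_push hs hall) hX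
            (by rw [hr]; exact fun e he => hcx.push hall (hc e he) (hmx e he).2 (hmx e he).1)
            hm hch.2 hP
            (by
              have := Compat.index_le (B := []) (by simpa using hcx) hall
              simp at this ⊢; omega)
          simpa [newWord, rowFold, bumps, h1, h2] using this
        · have hall : ∀ a ∈ X ++ y.1 :: N1, a < x.1 := by
            simp only [List.mem_append, List.mem_cons]
            rintro a (h | rfl | h)
            exacts [hX1 a h, hxy, hN1 a h]
          have hr : ∀ v, X ++ y.1 :: (N1 ++ v :: N2) = (X ++ y.1 :: N1) ++ v :: N2 := by simp
          have h1 : rowInsert x.1 (X ++ y.1 :: (N1 ++ u :: N2)) =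
              (X ++ y.1 :: (N1 ++ x.1 :: N2), some u) := by
            rw [hr, rowInsert_bump _ (fun a ha => (hall a ha).le) hu, hr]
          have h2 : rowInsert x.1 (X ++ (N1 ++ u :: N2)) =
              (X ++ (N1 ++ x.1 :: N2), some u) := by
            rw [← List.append_assoc,
              rowInsert_bump _ (fun a ha => (hall a (by simp at ha ⊢; tauto)).le) hu]
            simp
          rw [hr] at hs hcx
          have := ih X y (N1 ++ x.1 :: N2) P
            (by rw [hr]; exact pairwise_bump hs hall hu) hX
            (by
              rw [hr]
              exact fun e he => hcx.bump hall (hr u ▸ hc e he) (hmx e he).2 (hmx e he).1)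
            hm hch.2 hP (by simpa using hlen)
          simpa [newWord, rowFold, bumps, h1, h2] using this
      · have hr : ∀ v, (X1 ++ v :: X2) ++ y.1 :: N = X1 ++ v :: (X2 ++ y.1 :: N) := by simp
        have h1 : rowInsert x.1 ((X1 ++ u :: X2) ++ y.1 :: N) =
            ((X1 ++ x.1 :: X2) ++ y.1 :: N, some u) := by
          rw [hr, rowInsert_bump _ (fun a ha => (hX1 a ha).le) hu, hr]
        have h2 : rowInsert x.1 ((X1 ++ u :: X2) ++ N) =
            ((X1 ++ x.1 :: X2) ++ N, some u) := by
          rw [List.append_assoc, List.cons_append,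
            rowInsert_bump _ (fun a ha => (hX1 a ha).le) hu]
          simp
        simp only [List.append_assoc, List.cons_append] at h1 h2
        rw [hr] at hs hcx
        have := ih (X1 ++ x.1 :: X2) y N P
          (by rw [hr]; exact pairwise_bump hs hX1 hu) (by simpa using hX)
          (by
            rw [hr]
            exact fun e he => hcx.bump hX1 (hr u ▸ hc e he) (hmx e he).2 (hmx e he).1)
          hm hch.2 hP (by simpa using hlen)
        simpa [newWord, rowFold, bumps, h1, h2] using this
    | true =>
      simp only [ChainTo] at hch
      obtain ⟨hyx, hlab, hch⟩ := hch
      have hall : ∀ a ∈ X ++ [y.1], a < x.1 := by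
        simp only [List.mem_append, List.mem_singleton]
        rintro a (h | rfl)
        exacts [(hs'.2.2 a h y.1 (by simp)).trans hyx, hyx]
      have hallX : ∀ a ∈ X, a < y.1 := fun a h => hs'.2.2 a h y.1 (by simp)
      have hr : ∀ N', X ++ y.1 :: N' = (X ++ [y.1]) ++ N' := by simp
      rw [hr] at hs hcx
      cases N with
      | nil =>
        simp only [List.append_nil] at hs hcx
        have h1 : rowInsert x.1 (X ++ [y.1]) = (X ++ [y.1] ++ [x.1], none) :=
          rowInsert_end fun a ha => (hall a ha).le
        have h2 : rowInsert y.1 X = (X ++ [y.1], none) :=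
          rowInsert_end fun a ha => (hallX a ha).le
        have := ih (X ++ [y.1]) x [] P (pairwise_push hs hall) (by simp; omega)
          (fun e he => hcx.push hall (hc e he) (hmx e he).2 (hmx e he).1) hm hch hP
          (by simp; omega)
        simpa [newWord, rowFold, bumps, h1, h2] using this
      | cons n N =>
        -- `n` sits at the index that is the label of `x`, too far right for an entry below `x`. So
        -- `x` bumps `n` from the first row, and `y` bumps it from the second.
        have hn : x.1 < n := hcx.lt_of (by simp; omega)
        have h1 : rowInsert x.1 (X ++ y.1 :: n :: N) = (X ++ [y.1] ++ x.1 :: N, some n) := by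
          rw [hr, rowInsert_bump _ (fun a ha => (hall a ha).le) hn]
        have h2 : rowInsert y.1 (X ++ n :: N) = (X ++ y.1 :: N, some n) :=
          rowInsert_bump _ (fun a ha => (hallX a ha).le) (hyx.trans hn)
        have := ih (X ++ [y.1]) x N P (pairwise_bump hs hall hn) (by simp; omega)
          (fun e he => hcx.bump hall (hr _ ▸ hc e he) (hmx e he).2 (hmx e he).1) hm hch hP
          (by simpa using hlen)
        simpa [newWord, rowFold, bumps, h1, h2] using this


/-- Inserting `w` in `r` and `w'` in `r'` gives the same row, and the bumped words, the first one
preceded by `α`, are related by delaying marked letters. The letter `α` sits in `r'` at index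
`p`. -/
def Shifts (r r' w w' : List ℕ) (α p : ℕ) : Prop :=
  ∃ (l : List (Bool × ℕ × ℕ)) (rest : List ℕ) (P : ℕ),
    rowFold r w = rowFold r' w' ∧
    bumps r w = (l.map Prod.snd).map Prod.fst ++ rest ∧
    bumps r' w' = (newWord (α, p) l).map Prod.fst ++ rest ∧
    (l.map Prod.snd).Pairwise Mono ∧ ChainTo (α, p) l P ∧
    (∀ e ∈ l.map Prod.snd, e.2 ≤ P ∧ Fut r' e) ∧ r'.length ≤ P + 1

/-- Both insertions bump the same `u`, which becomes an unmarked letter. It is labelled by its index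
in the row of the delayed word; `hp` keeps this different from the label of `α`. -/
theorem Shifts.bump {A B A' B' w w' : List ℕ} {u x x' α p : ℕ}
    (h : Shifts (A ++ x :: B) (A' ++ x' :: B') w w' α p)
    (hA : ∀ a ∈ A, a < x) (hA' : ∀ a ∈ A', a < x') (hx : x < u) (hx' : x' < u)
    (hs : (A' ++ u :: B').Pairwise (· < ·)) (hp : A'.length ≠ p) :
    Shifts (A ++ u :: B) (A' ++ u :: B') (x :: w) (x' :: w') α p := by
  obtain ⟨l, rest, P, h1, h2, h3, h4, h5, h6, h7⟩ := h
  have i1 := rowInsert_bump B (fun a ha => (hA a ha).le) hx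
  have i2 := rowInsert_bump B' (fun a ha => (hA' a ha).le) hx'
  refine ⟨(false, u, A'.length) :: l, rest, P, ?_, ?_, ?_, ?_, ⟨hp, h5⟩, ?_, by simpa using h7⟩
  · simpa [rowFold, i1, i2] using h1
  · simpa [bumps, i1] using h2
  · simpa [bumps, i2, newWord] using h3
  · simp only [List.map_cons, List.pairwise_cons]
    exact ⟨fun f hf => (h6 f hf).2.mono (pairwise_bump hs hA' hx') rfl hx'.le, h4⟩
  · simp only [List.map_cons, List.forall_mem_cons]
    refine ⟨⟨?_, ?_⟩, fun e he => ⟨(h6 e he).1, (h6 e he).2.of_bump hx'.le⟩⟩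
    · simp at h7; omega
    · intro v hv; simp at hv; omega

/-- The first row releases `u` while the second releases `α`, the left neighbour of `u` there. So
`u` is the next marked letter and takes over from `α` as the delayed one. -/
theorem Shifts.exchange {A B A' B' w w' : List ℕ} {u x x' α : ℕ}
    (h : Shifts (A ++ x :: B) (A' ++ x' :: u :: B') w w' u (A'.length + 1))
    (hA : ∀ a ∈ A, a < x) (hA' : ∀ a ∈ A', a < x') (hx : x < u) (hx' : x' < α)
    (hs : (A' ++ α :: u :: B').Pairwise (· < ·)) :
    Shifts (A ++ u :: B) (A' ++ α :: u :: B') (x :: w) (x' :: w') α A'.length := by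
  obtain ⟨l, rest, P, h1, h2, h3, h4, h5, h6, h7⟩ := h
  have i1 := rowInsert_bump B (fun a ha => (hA a ha).le) hx
  have i2 := rowInsert_bump (u :: B') (fun a ha => (hA' a ha).le) hx'
  have hs' := (List.pairwise_append.1 hs).2.1
  have hαu : α < u := (List.pairwise_cons.1 hs').1 u (by simp)
  have hs1 := pairwise_bump hs hA' hx'
  refine ⟨(true, u, A'.length + 1) :: l, rest, P, ?_, ?_, ?_, ?_, ⟨hαu, rfl, h5⟩, ?_,
    by simpa using h7⟩
  · simpa [rowFold, i1, i2] using h1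
  · simpa [bumps, i1] using h2
  · simpa [bumps, i2, newWord] using h3
  · simp only [List.map_cons, List.pairwise_cons]
    have e1 : A' ++ x' :: u :: B' = (A' ++ [x']) ++ u :: B' := by simp
    rw [e1] at h6 hs1
    exact ⟨fun f hf => (h6 f hf).2.mono hs1 (by simp) le_rfl, h4⟩
  · simp only [List.map_cons, List.forall_mem_cons]
    refine ⟨⟨?_, ?_⟩, fun e he => ⟨(h6 e he).1, (h6 e he).2.of_bump hx'.le⟩⟩
    · simp at h7; omega
    · intro v hv
      rw [List.getElem?_append_right (by simp)] at hv
      simp at hv; omega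

theorem Shifts.push {r r' w w' : List ℕ} {x α p : ℕ}
    (h : Shifts (r ++ [x]) (r' ++ [x]) w w' α p)
    (hr : ∀ a ∈ r, a < x) (hr' : ∀ a ∈ r', a < x) :
    Shifts r r' (x :: w) (x :: w') α p := by
  obtain ⟨l, rest, P, h1, h2, h3, h4, h5, h6, h7⟩ := h
  have i1 := rowInsert_end (fun a ha => (hr a ha).le)
  have i2 := rowInsert_end (fun a ha => (hr' a ha).le)
  refine ⟨l, rest, P, ?_, ?_, ?_, h4, h5, fun e he => ⟨(h6 e he).1, (h6 e he).2.of_push⟩, ?_⟩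
  · simpa [rowFold, i1, i2] using h1
  · simpa [bumps, i1] using h2
  · simpa [bumps, i2] using h3
  · simp at h7; omega

/-- The second row releases its last entry `α` while the first merely grows. Nothing bumped later is
delayed, so the bumped words agree after `α`. -/
theorem Shifts.close {r A' w w' : List ℕ} {x x' α : ℕ}
    (h : rowFold (r ++ [x]) w = rowFold (A' ++ [x']) w' ∧
      bumps (r ++ [x]) w = bumps (A' ++ [x']) w')
    (hr : ∀ a ∈ r, a < x) (hA' : ∀ a ∈ A', a < x') (hx' : x' < α) :
    Shifts r (A' ++ [α]) (x :: w) (x' :: w') α A'.length := by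
  have i1 := rowInsert_end (fun a ha => (hr a ha).le)
  have i2 := rowInsert_bump [] (fun a ha => (hA' a ha).le) hx'
  refine ⟨[], bumps (r ++ [x]) w, A'.length, ?_, ?_, ?_, by simp, rfl, by simp, by simp⟩
  · simpa [rowFold, i1, i2] using h.1
  · simp [bumps, i1]
  · simp [bumps, i2, newWord, h.2]

/-- The first row has already lost `α`; the second still holds it and lacks `y`. The two differences
evolve independently until `α` leaves the second row: then either the right neighbour of `α` becomes
the new `α` (`Shifts.exchange`), or `α` was last and, unless the words end there, the situation of
`shift_closed` is reached (`Shifts.close`). -/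
theorem shifts_of_chainTo : ∀ (l : List (Bool × ℕ × ℕ)) (X : List ℕ) (y : ℕ × ℕ) (M : List ℕ)
    (α : ℕ) (N : List ℕ) (P : ℕ),
    (X ++ y.1 :: (M ++ α :: N)).Pairwise (· < ·) → X.length = y.2 →
    (∀ e ∈ l.map Prod.snd, Compat (X ++ y.1 :: (M ++ N)) e ∧ e.1 ≠ α) →
    (l.map Prod.snd).Pairwise Good →
    ChainTo y l P → (∀ e ∈ l.map Prod.snd, e.2 ≤ P) →
    (X ++ y.1 :: (M ++ N)).length ≤ P + 1 →
    Shifts (X ++ y.1 :: (M ++ N)) (X ++ (M ++ α :: N)) ((l.map Prod.snd).map Prod.fst)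
      ((newWord y l).map Prod.fst) α (X ++ M).length := by
  intro l
  induction l with
  | nil =>
    intro X y M α N P hs hX _ _ hch _ hlen
    simp only [ChainTo] at hch
    simp only [List.length_append, List.length_cons] at hlen
    obtain rfl : M = [] := List.length_eq_zero_iff.1 (by omega)
    obtain rfl : N = [] := List.length_eq_zero_iff.1 (by omega)
    have hs' := List.pairwise_append.1 hs
    have h1 : rowInsert y.1 (X ++ [α]) = (X ++ [y.1], some α) :=
      rowInsert_bump _ (fun a ha => (hs'.2.2 a ha y.1 (by simp)).le)
        ((List.pairwise_cons.1 hs'.2.1).1 α (by simp))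
    exact ⟨[], [], X.length, by simp [newWord, rowFold, bumps, h1, ChainTo]⟩
  | cons e l ih =>
    intro X y M α N P hs hX hc hm hch hP hlen
    obtain ⟨b, x⟩ := e
    simp only [List.map_cons, List.forall_mem_cons, List.pairwise_cons] at hc hm hP
    obtain ⟨⟨hcx, hxα⟩, hc⟩ := hc
    obtain ⟨hmx, hm⟩ := hm
    obtain ⟨hPx, hP⟩ := hP
    have hs' := List.pairwise_append.1 hs
    have hyN := List.pairwise_cons.1 hs'.2.1
    have hM' := List.pairwise_append.1 hyN.2
    have hN' := List.pairwise_cons.1 hM'.2.1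
    have hnew : (X ++ (M ++ α :: N)).Pairwise (· < ·) :=
      hs.sublist ((List.sublist_cons_self _ _).append_left _)
    cases b with
    | false =>
      simp only [ChainTo] at hch
      simp only [List.map_cons, newWord]
      have hnot := hcx.1
      simp only [List.mem_append, List.mem_cons, not_or] at hnot
      rcases exists_split hnot.1 with hX1 | ⟨X1, u, X2, rfl, hX1, hu⟩
      · have hxy : y.1 < x.1 := by
          rcases lt_or_gt_of_ne hnot.2.1 with h | h
          · have h1 := label_le_of_chainTo l hch.2 hPx (fun e he => (hmx e he).2) h
            have h2 := hcx.index_le hX1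
            have := hch.1
            omega
          · exact h
        rcases exists_split hnot.2.2.1 with hM1 | ⟨M1, u, M2, rfl, hM1, hu⟩
        · have hall : ∀ a ∈ X ++ y.1 :: M, a < x.1 := by
            simp only [List.mem_append, List.mem_cons]
            rintro a (h | rfl | h)
            exacts [hX1 a h, hxy, hM1 a h]
          -- Past `M`, the letter meets `α` in the second row but the head of `N` in the first; the
          -- insertions part company only if `x.1 < α`.
          rcases lt_or_gt_of_ne hxα with hα | hα
          · cases N with
            | nil =>
              rw [← List.append_assoc]
              simp only [List.append_nil] at hcx hc hlen ⊢
              refine Shifts.close ?_ hall (fun a ha => hall a (by simp at ha ⊢; tauto)) hα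
              have := shift_closed l X y (M ++ [x.1]) P
                (by simpa using pairwise_bump (A := X ++ y.1 :: M) (by simpa using hs) hall hα) hX
                (fun e he => by
                  simpa using hcx.push hall (hc e he).1 (hmx e he).2 (hmx e he).1)
                hm hch.2 hP
                (by
                  have := Compat.index_le (B := []) (by simpa using hcx) hall
                  simp at this ⊢; omega)
              simpa using this
            | cons n N =>
              have hn : α < n := hN'.1 n (by simp)
              have hr : ∀ v, X ++ y.1 :: (M ++ v :: N) = (X ++ y.1 :: M) ++ v :: N := by simp
              rw [← List.append_assoc X M, hr]
              refine Shifts.exchange ?_ hall (fun a ha => hall a (by simp at ha ⊢; tauto))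
                (hα.trans hn) hα (by simpa using hnew)
              rw [hr] at hcx
              have := ih X y (M ++ [x.1]) n N P
                (by simpa using pairwise_bump (A := X ++ y.1 :: M) (by simpa using hs) hall hα) hX
                (fun e he => by
                  have hce := (hc e he).1
                  have hne : e.1 ≠ n := fun h0 => hce.1 (by simp [h0])
                  rw [hr] at hce
                  simpa [hne] using hcx.bump hall hce (hmx e he).2 (hmx e he).1)
                hm hch.2 hP (by simpa using hlen)
              simpa [← add_assoc] using this
          · rcases exists_split hnot.2.2.2 with hN1 | ⟨N1, u, N2, rfl, hN1, hu⟩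
            · have hall' : ∀ a ∈ X ++ y.1 :: (M ++ α :: N), a < x.1 := by
                simp only [List.mem_append, List.mem_cons]
                rintro a (h | rfl | h | rfl | h)
                exacts [hX1 a h, hxy, hM1 a h, hα, hN1 a h]
              have hall2 : ∀ a ∈ X ++ y.1 :: (M ++ N), a < x.1 := fun a ha =>
                hall' a (by simp at ha ⊢; tauto)
              refine Shifts.push ?_ hall2 (fun a ha => hall' a (by simp at ha ⊢; tauto))
              have := ih X y M α (N ++ [x.1]) P
                (by simpa using pairwise_push hs hall') hX
                (fun e he => ⟨by
                  simpa using hcx.push hall2 (hc e he).1 (hmx e he).2 (hmx e he).1, (hc e he).2⟩)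
                hm hch.2 hP
                (by
                  have := Compat.index_le (B := []) (by simpa using hcx) hall2
                  simp at this ⊢; omega)
              simpa using this
            · have hall' : ∀ a ∈ X ++ y.1 :: (M ++ α :: N1), a < x.1 := by
                simp only [List.mem_append, List.mem_cons]
                rintro a (h | rfl | h | rfl | h)
                exacts [hX1 a h, hxy, hM1 a h, hα, hN1 a h]
              have hall2 : ∀ a ∈ X ++ y.1 :: (M ++ N1), a < x.1 := fun a ha =>
                hall' a (by simp at ha ⊢; tauto)
              have hr : ∀ v, X ++ y.1 :: (M ++ (N1 ++ v :: N2)) =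
                (X ++ y.1 :: (M ++ N1)) ++ v :: N2 := by simp
              have hr' : ∀ v, X ++ (M ++ α :: (N1 ++ v :: N2)) =
                (X ++ (M ++ α :: N1)) ++ v :: N2 := by simp
              rw [hr] at hcx ⊢
              rw [hr'] at hnew ⊢
              refine Shifts.bump ?_ hall2 (fun a ha => hall' a (by simp at ha ⊢; tauto)) hu hu hnew
                (by simp)
              rw [← hr, ← hr']
              refine ih X y M α (N1 ++ x.1 :: N2) P
                (by simpa using
                  pairwise_bump (A := X ++ y.1 :: (M ++ α :: N1)) (by simpa using hs) hall' hu) hX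
                (fun e he => ⟨by
                  rw [hr]
                  exact hcx.bump hall2 (hr u ▸ (hc e he).1) (hmx e he).2 (hmx e he).1,
                  (hc e he).2⟩)
                hm hch.2 hP (by simpa using hlen)
        · have hall : ∀ a ∈ X ++ y.1 :: M1, a < x.1 := by
            simp only [List.mem_append, List.mem_cons]
            rintro a (h | rfl | h)
            exacts [hX1 a h, hxy, hM1 a h]
          have hr : ∀ v, X ++ y.1 :: ((M1 ++ v :: M2) ++ N) =
            (X ++ y.1 :: M1) ++ v :: (M2 ++ N) := by simp
          have hr' : ∀ v, X ++ ((M1 ++ v :: M2) ++ α :: N) =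
            (X ++ M1) ++ v :: (M2 ++ α :: N) := by simp
          rw [hr] at hcx ⊢
          rw [hr'] at hnew ⊢
          refine Shifts.bump ?_ hall (fun a ha => hall a (by simp at ha ⊢; tauto)) hu hu hnew
            (by simp)
          rw [← hr, ← hr']
          have := ih X y (M1 ++ x.1 :: M2) α N P
            (by simpa using pairwise_bump (A := X ++ y.1 :: M1) (by simpa using hs) hall hu) hX
            (fun e he => ⟨by
              rw [hr]
              exact hcx.bump hall (hr u ▸ (hc e he).1) (hmx e he).2 (hmx e he).1,
              (hc e he).2⟩)
            hm hch.2 hP (by simpa using hlen)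
          simpa using this
      · have hr : ∀ v, (X1 ++ v :: X2) ++ y.1 :: (M ++ N) =
          X1 ++ v :: (X2 ++ y.1 :: (M ++ N)) := by simp
        have hr' : ∀ v, (X1 ++ v :: X2) ++ (M ++ α :: N) =
          X1 ++ v :: (X2 ++ (M ++ α :: N)) := by simp
        rw [hr] at hcx ⊢
        rw [hr'] at hnew ⊢
        refine Shifts.bump ?_ hX1 hX1 hu hu hnew (by simp)
        rw [← hr, ← hr']
        have := ih (X1 ++ x.1 :: X2) y M α N P
          (by simpa using pairwise_bump (A := X1) (by simpa using hs) hX1 hu) (by simpa using hX)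
          (fun e he => ⟨by
            rw [hr]
            exact hcx.bump hX1 (hr u ▸ (hc e he).1) (hmx e he).2 (hmx e he).1, (hc e he).2⟩)
          hm hch.2 hP (by simpa using hlen)
        simpa using this
    | true =>
      simp only [ChainTo] at hch
      simp only [List.map_cons, newWord]
      obtain ⟨hyx, hlab, hch⟩ := hch
      have hallX : ∀ a ∈ X, a < y.1 := fun a h => hs'.2.2 a h y.1 (by simp)
      have hall : ∀ a ∈ X ++ [y.1], a < x.1 := by
        simp only [List.mem_append, List.mem_singleton]
        rintro a (h | rfl)
        exacts [(hallX a h).trans hyx, hyx]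
      have hr : ∀ N', X ++ y.1 :: N' = (X ++ [y.1]) ++ N' := by simp
      rw [hr] at hcx ⊢
      cases M with
      | nil =>
        cases N with
        | nil =>
          simp only [List.append_nil, List.nil_append] at hcx hc hs ⊢
          refine Shifts.close ?_ hall hallX (hyN.1 α (by simp))
          have := shift_closed l (X ++ [y.1]) x [] P
            (pairwise_push (hs.sublist (by simp)) hall) (by simp; omega)
            (fun e he => hcx.push hall (hc e he).1 (hmx e he).2 (hmx e he).1) hm hch hP
            (by simp; omega)
          simpa using this
        | cons n N =>
          simp only [List.append_nil, List.nil_append] at hcx hc hs hlen hnew ⊢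
          have hn : x.1 < n := hcx.lt_of (by simp; omega)
          refine Shifts.exchange ?_ hall hallX hn (hyN.1 α (by simp)) hnew
          have := ih (X ++ [y.1]) x [] n N P
            (pairwise_insert ((by simpa using hs :
              ((X ++ [y.1]) ++ α :: n :: N).Pairwise (· < ·)).sublist (by simp)) hall hn)
            (by simp; omega)
            (fun e he => by
              have hce := (hc e he).1
              have hne : e.1 ≠ n := fun h0 => hce.1 (by simp [h0])
              rw [hr] at hce
              exact ⟨hcx.bump hall hce (hmx e he).2 (hmx e he).1, hne⟩) hm hch hP
            (by simpa using hlen)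
          simpa using this
      | cons m M =>
        simp only [List.cons_append] at hcx hc hs hlen hnew ⊢
        have hn : x.1 < m := hcx.lt_of (by simp; omega)
        refine Shifts.bump ?_ hall hallX hn (hyx.trans hn) hnew (by simp)
        have := ih (X ++ [y.1]) x M α N P
          (pairwise_bump (by simpa using hs) hall hn) (by simp; omega)
          (fun e he => ⟨hcx.bump hall (hr _ ▸ (hc e he).1) (hmx e he).2 (hmx e he).1,
            (hc e he).2⟩) hm hch hP (by simpa using hlen)
        simpa [Nat.add_assoc, Nat.add_comm 1] using this

/-! ### Letters bumped by the common prefix -/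

/-- The entry of the row `r` at the index that is the label of `e` does not exceed `e`. -/
def Past (r : List ℕ) (e : ℕ × ℕ) : Prop := ∃ v, r[e.2]? = some v ∧ v ≤ e.1

/-- Insertion never raises the entry at an index, so `Past` persists forwards in time, opposite to
`Fut`. -/
theorem Past.rowInsert {r : List ℕ} {e : ℕ × ℕ} (x : ℕ) (h : Past r e) :
    Past (rowInsert x r).1 e := by
  obtain ⟨u, i⟩ := e
  induction r generalizing i with
  | nil => obtain ⟨v, hv, _⟩ := h; simp at hv
  | cons a r ih =>
    obtain ⟨v, hv, hvu⟩ := h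
    simp only at hv hvu
    rw [GenKnuth.rowInsert]
    cases i with
    | zero =>
      simp at hv
      split_ifs with hx
      · exact ⟨x, by simp, by simp; omega⟩
      · exact ⟨a, by simp, by simp; omega⟩
    | succ i =>
      simp only [List.getElem?_cons_succ] at hv
      split_ifs with hx
      · exact ⟨v, by simpa using hv, hvu⟩
      · obtain ⟨v', hv', h'⟩ := ih i ⟨v, hv, hvu⟩
        exact ⟨v', by simpa using hv', h'⟩

theorem Past.rowFold {e : ℕ × ℕ} (w : List ℕ) : ∀ {r : List ℕ}, Past r e →
    Past (rowFold r w) e := by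
  induction w with
  | nil => exact id
  | cons x w ih => exact fun h => ih (h.rowInsert x)

/-- Compares a letter bumped early with one bumped late: `e < f` gives `r[e.2] ≤ e < f ≤ r[f.2]` in
an increasing row; an `f.2` beyond the end is larger anyway. -/
theorem Past.mono {r : List ℕ} {e f : ℕ × ℕ} (he : Past r e) (hf : Fut r f)
    (hs : r.Pairwise (· < ·)) : Mono e f := by
  obtain ⟨v, hv, hve⟩ := he
  obtain ⟨hlt, rfl⟩ := List.getElem?_eq_some_iff.1 hv
  intro hef
  by_contra hle
  rw [not_lt] at hle
  have h1 := hf r[f.2] (by simp)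
  have h2 : r[f.2] ≤ r[e.2] := by
    rcases hle.lt_or_eq with h | h
    · exact (List.pairwise_iff_getElem.1 hs _ _ _ _ h).le
    · simp [h]
  omega

/-- Handles the letters before the chain. `Past` in the final row is recorded so that these bumped
letters can be compared with those bumped afterwards. -/
theorem exists_bumps (w F : List (ℕ × ℕ)) : ∀ (r : List ℕ) (P : ℕ), r.Pairwise (· < ·) →
    (∀ e ∈ w ++ F, Compat r e) → (w ++ F).Pairwise Good → (∀ e ∈ w, e.2 ≤ P) →
    r.length ≤ P + 1 →
    ∃ β : List (ℕ × ℕ), bumps r (w.map Prod.fst) = β.map Prod.fst ∧ β.Pairwise Mono ∧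
      (∀ e ∈ β, Fut r e ∧ Past (rowFold r (w.map Prod.fst)) e) ∧
      (rowFold r (w.map Prod.fst)).Pairwise (· < ·) ∧
      (∀ e ∈ F, Compat (rowFold r (w.map Prod.fst)) e) ∧
      (rowFold r (w.map Prod.fst)).length ≤ P + 1 := by
  induction w with
  | nil => intro r P hs hc _ _ hl; exact ⟨[], by simpa [bumps, rowFold] using ⟨hs, by simpa using hc, hl⟩⟩
  | cons x w ih =>
    intro r P hs hc hm hP hl
    simp only [List.cons_append, List.forall_mem_cons, List.pairwise_cons] at hc hm hP
    obtain ⟨hcx, hc⟩ := hc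
    rcases exists_split hcx.1 with hall | ⟨A, u, B, rfl, hA, hu⟩
    · have i1 := rowInsert_end (fun a ha => (hall a ha).le)
      obtain ⟨β, h1, h2, h3, h4⟩ := ih (r ++ [x.1]) P (pairwise_push hs hall)
        (fun e he => hcx.push hall (hc e he) (hm.1 e he).2 (hm.1 e he).1) hm.2 hP.2
        (by
          have := Compat.index_le (B := []) (by simpa using hcx) hall
          have := hP.1
          simp; omega)
      refine ⟨β, ?_, h2, ?_, ?_⟩
      · simpa [bumps, i1] using h1
      · simpa [rowFold, i1] using fun a b h => ⟨(h3 (a, b) h).1.of_push, (h3 (a, b) h).2⟩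
      · simpa [rowFold, i1] using h4
    · have i1 := rowInsert_bump B (fun a ha => (hA a ha).le) hu
      have hs' := pairwise_bump hs hA hu
      obtain ⟨β, h1, h2, h3, h4⟩ := ih (A ++ x.1 :: B) P hs'
        (fun e he => hcx.bump hA (hc e he) (hm.1 e he).2 (hm.1 e he).1) hm.2 hP.2
        (by simpa using hl)
      refine ⟨(u, A.length) :: β, ?_, ?_, ?_, ?_⟩
      · simpa [bumps, i1] using h1
      · exact List.pairwise_cons.2 ⟨fun f hf => (h3 f hf).1.mono hs' rfl hu.le, h2⟩
      · simp only [List.forall_mem_cons, List.map_cons, rowFold, i1]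
        refine ⟨⟨?_, ?_⟩, fun e he => ⟨(h3 e he).1.of_bump hu.le, (h3 e he).2⟩⟩
        · intro v hv; simp at hv; omega
        · exact Past.rowFold _ ⟨x.1, by simp, hu.le⟩
      · simpa [rowFold, i1] using h4

theorem pairwise_good {w : List (ℕ × ℕ)} (hn : (w.map Prod.fst).Nodup) (hm : w.Pairwise Mono) :
    w.Pairwise Good :=
  (List.pairwise_map.1 hn).and hm

/-- Delaying the letters of a suitably labelled marked chain does not change the tableau. -/
theorem foldl_tableauInsert_newWord : ∀ (n : ℕ) (w : List (ℕ × ℕ)) (y : ℕ × ℕ)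
    (l : List (Bool × ℕ × ℕ)) (P : ℕ), w.length + l.length ≤ n →
    (w ++ y :: l.map Prod.snd).Pairwise Good → y.2 = 0 → ChainTo y l P →
    (∀ e ∈ w ++ l.map Prod.snd, e.2 ≤ P) →
    ((w ++ y :: l.map Prod.snd).map Prod.fst).foldl tableauInsert [] =
      ((w ++ newWord y l).map Prod.fst).foldl tableauInsert [] := by
  intro n
  induction n with
  | zero =>
    intro w y l P hn
    obtain rfl : w = [] := List.length_eq_zero_iff.1 (by omega)
    obtain rfl : l = [] := List.length_eq_zero_iff.1 (by omega)
    simp [newWord]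
  | succ n ih =>
    intro w y l P hn hm hy hch hP
    have hne : ∀ v, (newWord y v).map Prod.fst ≠ [] := fun v h => by
      have := (perm_newWord v y).length_eq
      simp [List.map_eq_nil_iff.1 h] at this
    have hnod : ((w ++ y :: l.map Prod.snd).map Prod.fst).Nodup :=
      List.pairwise_map.2 (hm.imp fun h => h.1)
    have hshort := length_bumps_lt
      (w := (w ++ y :: l.map Prod.snd).map Prod.fst) (by simp)
    have hnb := nodup_bumps hnod
    rw [foldl_tableauInsert_nil (w := (w ++ y :: l.map Prod.snd).map Prod.fst) (by simp),
      foldl_tableauInsert_nil (w := (w ++ newWord y l).map Prod.fst) (by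
        rw [List.map_append]
        exact fun h => hne l (List.append_eq_nil_iff.1 h).2)]
    obtain ⟨β, h1, h2, h3, h4, h5, h6⟩ := exists_bumps w (y :: l.map Prod.snd) [] P (by simp)
      (fun e _ => ⟨by simp, by simp⟩) hm (fun e he => hP e (by simp [he])) (by simp)
    simp only [List.map_append, rowFold_append, bumps_append, h1, List.map_cons, rowFold,
      bumps] at hshort hnb ⊢
    generalize rowFold [] (w.map Prod.fst) = r at *
    simp only [List.forall_mem_cons] at h5
    have hml := List.pairwise_cons.1 (List.pairwise_append.1 hm).2.1
    have hP' : ∀ e ∈ l.map Prod.snd, e.2 ≤ P := fun e he => hP e (List.mem_append_right _ he)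
    -- In an empty row `y` bumps nothing and becomes the pending letter of `shift_closed`. Otherwise
    -- `y`, having label `0`, bumps the first entry `α`, which heads the new chain, again with label
    -- `0`.
    cases r with
    | nil =>
      have h0 := shift_closed l [] y [] P (by simp) (by simp [hy])
        (fun e he => h5.1.push (by simp) (h5.2 e he) (hml.1 e he).2 (hml.1 e he).1)
        hml.2 hch hP' (by simp)
      simp only [List.nil_append] at h0
      simp only [rowInsert, Option.toList, List.nil_append, h0.1, h0.2]
    | cons α N =>
      have hyα : y.1 < α := Compat.lt_of (A := []) h5.1 (by simp [hy])
      have h0 := shifts_of_chainTo l [] y [] α N P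
        (pairwise_insert (A := []) h4 (by simp) hyα) (by simp [hy])
        (fun e he => ⟨Compat.bump (A := []) h5.1 (by simp) (h5.2 e he) (hml.1 e he).2
          (hml.1 e he).1, fun h => (h5.2 e he).1 (by simp [h])⟩)
        hml.2 hch hP' (by simpa using h6)
      obtain ⟨l', rest, P', e1, e2, e3, e4, e5, e6, e7⟩ := h0
      simp only [List.nil_append, List.append_nil, List.length_nil] at e1 e2 e3 e5 e6 e7
      simp only [rowInsert, hyα, if_true, Option.toList, e1, e2, e3] at hshort hnb ⊢
      have h7 : (((β ++ (α, 0) :: l'.map Prod.snd).map Prod.fst) ++ rest).Nodup := by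
        simpa using hnb
      have hfut : Fut (α :: N) (α, 0) := by intro v hv; simp at hv; omega
      -- The common suffix `rest` is cut off for the induction and inserted again afterwards.
      have := ih β (α, 0) l' P' (by simp at hshort hn; omega)
        (pairwise_good (List.nodup_append.1 h7).1
          (List.pairwise_append.2 ⟨h2, List.pairwise_cons.2
            ⟨fun f hf => Past.mono ⟨α, by simp, le_rfl⟩ (e6 f hf).2 h4, e4⟩, by
            intro e he f hf
            refine (h3 e he).2.mono ?_ h4
            rcases List.mem_cons.1 hf with rfl | hf
            exacts [hfut, (e6 f hf).2]⟩)) rfl e5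
        (by
          intro e he
          rcases List.mem_append.1 he with he | he
          · obtain ⟨v, hv, _⟩ := (h3 e he).2
            have := (List.getElem?_eq_some_iff.1 hv).1
            omega
          · exact (e6 e he).1)
      congr 1
      have h8 := congrArg (fun T => rest.foldl tableauInsert T) this
      simp only [← List.foldl_append] at h8
      simpa using h8

/-! ### Knuth equivalence -/

/-- The elementary Knuth relations. -/
inductive KnuthTriple : List ℕ → List ℕ → Prop
  | left {x y z : ℕ} (hxy : x ≤ y) (hyz : y < z) : KnuthTriple [x, z, y] [z, x, y]
  | right {x y z : ℕ} (hxy : x < y) (hyz : y ≤ z) : KnuthTriple [y, x, z] [y, z, x]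

/-- Knuth equivalence of words. -/
inductive Knuth : List ℕ → List ℕ → Prop
  | triple (u t : List ℕ) {a b : List ℕ} (h : KnuthTriple a b) : Knuth (u ++ a ++ t) (u ++ b ++ t)
  | refl (w : List ℕ) : Knuth w w
  | symm {v w : List ℕ} (h : Knuth v w) : Knuth w v
  | trans {u v w : List ℕ} (h : Knuth u v) (h' : Knuth v w) : Knuth u w

theorem Knuth.congr {v w : List ℕ} (h : Knuth v w) (u t : List ℕ) :
    Knuth (u ++ v ++ t) (u ++ w ++ t) := by
  induction h with
  | triple u' t' h => simpa using Knuth.triple (u ++ u') (t' ++ t) h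
  | refl w => exact .refl _
  | symm _ ih => exact ih.symm
  | trans _ _ ih ih' => exact ih.trans ih'

theorem Knuth.cons {v w : List ℕ} (h : Knuth v w) (x : ℕ) : Knuth (x :: v) (x :: w) := by
  simpa using h.congr [x] []

/-! ### Row insertion respects the Knuth relations -/

theorem exists_split_le (x : ℕ) (r : List ℕ) :
    (∀ a ∈ r, a ≤ x) ∨ ∃ A u B, r = A ++ u :: B ∧ (∀ a ∈ A, a ≤ x) ∧ x < u := by
  induction r with
  | nil => simp
  | cons a r ih =>
    rcases lt_or_ge x a with h | h
    · exact Or.inr ⟨[], a, r, by simp, by simp, h⟩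
    · rcases ih with h' | ⟨A, u, B, rfl, hA, hu⟩
      · left; simpa [h] using h'
      · exact Or.inr ⟨a :: A, u, B, by simp, by simpa [h] using hA, hu⟩

theorem pairwise_rowInsert (x : ℕ) {r : List ℕ} (hr : r.Pairwise (· ≤ ·)) :
    (rowInsert x r).1.Pairwise (· ≤ ·) := by
  rcases exists_split_le x r with h | ⟨A, u, B, rfl, hA, hu⟩
  · rw [rowInsert_end h]
    exact List.pairwise_append.2 ⟨hr, by simp, by simpa using h⟩
  · rw [rowInsert_bump B hA hu]
    rw [List.pairwise_append, List.pairwise_cons] at hr ⊢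
    refine ⟨hr.1, ⟨fun b hb => hu.le.trans (hr.2.1.1 b hb), hr.2.1.2⟩, ?_⟩
    intro a ha b hb
    rcases List.mem_cons.1 hb with rfl | hb
    exacts [hA a ha, hr.2.2 a ha b (by simp [hb])]

theorem mem_of_bumped {x u : ℕ} {r : List ℕ} (h : (rowInsert x r).2 = some u) :
    x < u ∧ u ∈ r ∧ x ∈ (rowInsert x r).1 := by
  rcases exists_split_le x r with h' | ⟨A, v, B, rfl, hA, hu⟩
  · rw [rowInsert_end h'] at h; cases h
  · rw [rowInsert_bump B hA hu] at h ⊢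
    cases h
    simp [hu]

theorem exists_bumped {y m : ℕ} {r : List ℕ} (hr : r.Pairwise (· ≤ ·)) (hm : m ∈ r) (h : y < m) :
    ∃ u, (rowInsert y r).2 = some u ∧ u ≤ m := by
  rcases exists_split_le y r with h' | ⟨A, v, B, rfl, hA, hu⟩
  · have := h' m hm; omega
  · rw [rowInsert_bump B hA hu]
    refine ⟨v, rfl, ?_⟩
    have hvB := (List.pairwise_cons.1 (List.pairwise_append.1 hr).2.1).1
    rcases List.mem_append.1 hm with hm | hm
    · have := hA m hm; omega
    · rcases List.mem_cons.1 hm with rfl | hm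
      exacts [le_rfl, hvB m hm]

theorem bumped_le_bumped {y z v : ℕ} {r : List ℕ} (hr : r.Pairwise (· ≤ ·)) (hyz : y ≤ z)
    (h : (rowInsert z (rowInsert y r).1).2 = some v) :
    ∃ u, (rowInsert y r).2 = some u ∧ u ≤ v := by
  rcases exists_split_le y r with h' | ⟨A, u, B, rfl, hA, hu⟩
  · rw [rowInsert_end h', rowInsert_end (by
      simp only [List.mem_append, List.mem_singleton]
      rintro a (ha | rfl)
      exacts [(h' a ha).trans hyz, hyz])] at h
    cases h
  · rw [rowInsert_bump B hA hu] at h ⊢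
    refine ⟨u, rfl, ?_⟩
    obtain ⟨h1, h2, _⟩ := mem_of_bumped h
    have hvB := (List.pairwise_cons.1 (List.pairwise_append.1 hr).2.1).1
    rcases List.mem_append.1 h2 with hm | hm
    · have := hA v hm; omega
    · rcases List.mem_cons.1 hm with rfl | hm
      · omega
      · exact hvB v hm

/-- A first entry not above any inserted letter is inert; `rowFold_knuthTriple` strips such entries.
-/
theorem rowFold_cons_of_le {a : ℕ} (w : List ℕ) : ∀ (r : List ℕ), (∀ x ∈ w, a ≤ x) →
    rowFold (a :: r) w = a :: rowFold r w ∧ bumps (a :: r) w = bumps r w := by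
  induction w with
  | nil => simp [rowFold, bumps]
  | cons x w ih =>
    intro r h
    have hx : ¬ x < a := by simpa using h x (by simp)
    have := ih (rowInsert x r).1 fun b hb => h b (by simp [hb])
    simp [rowFold, bumps, rowInsert, hx, this]

/-- The first entry `c` can be stripped unless it exceeds the smallest letter `x`; its order against
`z` or `y` then decides which letters come out. The relation between the bumped words may have the
other kind or direction, hence the disjunction. -/
theorem rowFold_knuthTriple {a b : List ℕ} (h : KnuthTriple a b) {r : List ℕ}
    (hr : r.Pairwise (· ≤ ·)) :
    rowFold r a = rowFold r b ∧ (bumps r a = bumps r b ∨ KnuthTriple (bumps r a) (bumps r b) ∨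
      KnuthTriple (bumps r b) (bumps r a)) := by
  induction r with
  | nil =>
    cases h with
    | @left x y z hxy hyz =>
      have h1 : ¬ z < x := by omega
      have h2 : ¬ y < x := by omega
      have h3 : x < z := by omega
      simp [rowFold, bumps, rowInsert, h1, h2, h3, hyz]
    | @right x y z hxy hyz =>
      have h1 : ¬ z < x := by omega
      have h2 : ¬ z < y := by omega
      simp [rowFold, bumps, rowInsert, h1, h2, hxy]
  | cons c r ih =>
    obtain ⟨hc, hr⟩ := List.pairwise_cons.1 hr
    cases h with
    | @left x y z hxy hyz =>
      have hzx : ¬ z < x := by omega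
      have hyx : ¬ y < x := by omega
      have hxz : x < z := by omega
      rcases le_or_gt c x with hcx | hxc
      · obtain ⟨e1, e2⟩ := rowFold_cons_of_le [x, z, y] r (a := c) (by simp; omega)
        obtain ⟨e3, e4⟩ := rowFold_cons_of_le [z, x, y] r (a := c) (by simp; omega)
        rw [e1, e2, e3, e4]
        have := ih hr
        exact ⟨by rw [this.1], this.2⟩
      · rcases lt_or_ge z c with hzc | hcz
        · cases r with
          | nil => simp [rowFold, bumps, rowInsert, hzx, hyx, hxz, hxc, hzc, hyz]
          | cons d r =>
            have hcd : c ≤ d := hc d (by simp)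
            have hzd : z < d := by omega
            have hyd : y < d := by omega
            have := KnuthTriple.right hzc hcd
            simp [rowFold, bumps, rowInsert, hzx, hyx, hxz, hxc, hzc, hyz, hzd, hyd, this]
        · have hzc : ¬ z < c := by omega
          simp only [rowFold, bumps, rowInsert, hzx, hyx, hxc, hzc, if_true, if_false,
            Option.toList_some, List.append_nil, true_and]
          cases hz : (rowInsert z r).2 with
          | none => simp
          | some z' =>
            obtain ⟨h1, h2, h3⟩ := mem_of_bumped hz
            -- `z` is now in the row, so `y < z` bumps something at most `z`, hence below `z'`.
            obtain ⟨y', h4, h5⟩ := exists_bumped (pairwise_rowInsert z hr) h3 hyz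
            obtain ⟨h6, h7, -⟩ := mem_of_bumped h4
            have h8 : y' ∈ z :: r := (perm_rowInsert z r).subset (by simp [h7])
            have h9 : c ≤ y' := by
              rcases List.mem_cons.1 h8 with rfl | h8
              exacts [hcz, hc y' h8]
            right; left
            rw [h4]
            exact KnuthTriple.left h9 (by omega)
    | @right x y z hxy hyz =>
      have hzx : ¬ z < x := by omega
      have hyx : ¬ y < x := by omega
      have hzy : ¬ z < y := by omega
      rcases le_or_gt c x with hcx | hxc
      · obtain ⟨e1, e2⟩ := rowFold_cons_of_le [y, x, z] r (a := c) (by simp; omega)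
        obtain ⟨e3, e4⟩ := rowFold_cons_of_le [y, z, x] r (a := c) (by simp; omega)
        rw [e1, e2, e3, e4]
        have := ih hr
        exact ⟨by rw [this.1], this.2⟩
      · rcases lt_or_ge y c with hyc | hcy
        · simp only [rowFold, bumps, rowInsert, hzx, hzy, hxy, hyc, if_true, if_false,
            Option.toList_some, List.append_nil, true_and]
          cases hz : (rowInsert z r).2 with
          | none => simp
          | some z' =>
            obtain ⟨h1, h2, -⟩ := mem_of_bumped hz
            right; left
            exact KnuthTriple.right hyc (hc z' h2)
        · have hyc : ¬ y < c := by omega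
          have hzc : ¬ z < c := by omega
          simp only [rowFold, bumps, rowInsert, hzx, hyc, hzc, hxc, if_true, if_false,
            Option.toList_some, List.append_nil, true_and]
          cases hz : (rowInsert z (rowInsert y r).1).2 with
          | none => simp
          | some z' =>
            obtain ⟨y', h1, h2⟩ := bumped_le_bumped hr hyz hz
            have := (mem_of_bumped h1).1
            rw [h1]
            right; left
            exact KnuthTriple.right (by omega) h2

theorem foldl_tableauInsert_knuthTriple : ∀ (T : List (List ℕ)) {a b : List ℕ},
    (∀ r ∈ T, r.Pairwise (· ≤ ·)) → KnuthTriple a b →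
    a.foldl tableauInsert T = b.foldl tableauInsert T
  | [], a, b, _, h => by
    have ha : a ≠ [] := by cases h <;> simp
    have hb : b ≠ [] := by cases h <;> simp
    rw [foldl_tableauInsert_nil ha, foldl_tableauInsert_nil hb,
      (rowFold_knuthTriple h List.Pairwise.nil).1]
    congr 2
    cases h with
    | @left x y z hxy hyz =>
      have h1 : ¬ z < x := by omega
      have h2 : ¬ y < x := by omega
      have h3 : x < z := by omega
      simp [bumps, rowInsert, h1, h2, h3, hyz]
    | @right x y z hxy hyz =>
      have h1 : ¬ z < x := by omega
      have h2 : ¬ z < y := by omega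
      simp [bumps, rowInsert, h1, h2, hxy]
  | r :: T, a, b, hT, h => by
    rw [foldl_tableauInsert_cons, foldl_tableauInsert_cons]
    obtain ⟨h1, h2⟩ := rowFold_knuthTriple h (hT r (by simp))
    have hT' : ∀ r ∈ T, r.Pairwise (· ≤ ·) := fun r hr => hT r (by simp [hr])
    rw [h1]
    congr 1
    rcases h2 with h2 | h2 | h2
    · rw [h2]
    · exact foldl_tableauInsert_knuthTriple T hT' h2
    · exact (foldl_tableauInsert_knuthTriple T hT' h2).symm

theorem pairwise_tableauInsert (x : ℕ) (T : List (List ℕ)) (hT : ∀ r ∈ T, r.Pairwise (· ≤ ·)) :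
    ∀ r ∈ tableauInsert T x, r.Pairwise (· ≤ ·) := by
  induction T generalizing x with
  | nil => simp [tableauInsert]
  | cons r T ih =>
    rw [tableauInsert_cons]
    simp only [List.forall_mem_cons] at hT ⊢
    refine ⟨pairwise_rowInsert x hT.1, ?_⟩
    cases (rowInsert x r).2 with
    | none => exact hT.2
    | some u => exact ih u hT.2

theorem pairwise_foldl_tableauInsert (w : List ℕ) : ∀ (T : List (List ℕ)),
    (∀ r ∈ T, r.Pairwise (· ≤ ·)) →
    ∀ r ∈ w.foldl tableauInsert T, r.Pairwise (· ≤ ·) := by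
  induction w with
  | nil => exact fun T h => h
  | cons x w ih => exact fun T h => ih _ (pairwise_tableauInsert x T h)

/-- Knuth equivalent words have the same insertion tableau. -/
theorem Knuth.foldl_tableauInsert {v w : List ℕ} (h : Knuth v w) :
    v.foldl tableauInsert [] = w.foldl tableauInsert [] := by
  induction h with
  | triple u t h =>
    simp only [List.foldl_append]
    rw [foldl_tableauInsert_knuthTriple _ (pairwise_foldl_tableauInsert u [] (by simp)) h]
  | refl w => rfl
  | symm _ ih => exact ih.symm
  | trans _ _ ih ih' => exact ih.trans ih'

/-! ### Every word is Knuth equivalent to the row word of its tableau -/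

/-- The row word of a tableau. -/
def rowWord : List (List ℕ) → List ℕ
  | [] => []
  | r :: T => rowWord T ++ r

/-- `x` travels left through `B`; each exchange `c b x ~ c x b` uses the left neighbour `c`, where
`x < c ≤ b`. -/
theorem knuth_cons_append {x y : ℕ} (hxy : x < y) : ∀ (B : List ℕ),
    (y :: B).Pairwise (· ≤ ·) → Knuth (y :: B ++ [x]) (y :: x :: B) := by
  intro B
  induction B using List.reverseRecOn with
  | nil => exact fun _ => .refl _
  | append_singleton B b ih =>
    intro h
    have hb : y :: (B ++ [b]) = (y :: B) ++ [b] := by simp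
    rw [hb] at h
    have h1 := ih (List.pairwise_append.1 h).1
    have h2 := h1.congr [] [b]
    refine Knuth.trans ?_ (by simpa using h2)
    rcases B.eq_nil_or_concat with rfl | ⟨B', c, rfl⟩
    · exact (Knuth.triple [] [] (KnuthTriple.right hxy (by simpa using h))).symm
    · have hyc : y ≤ c := (List.pairwise_cons.1 (List.pairwise_append.1 h).1).1 c (by simp)
      have hcb : c ≤ b := (List.pairwise_append.1 h).2.2 c (by simp) b (by simp)
      simpa using (Knuth.triple (y :: B') []
        (KnuthTriple.right (x := x) (y := c) (z := b) (by omega) hcb)).symm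

/-- If `x` passes `y`, the letter `u` bumped from the tail must still move in front of `y`. The new
tail begins with some `c` satisfying `y ≤ c < u`, so `y u c ~ u y c` applies. -/
theorem knuth_rowInsert (x : ℕ) (r : List ℕ) (hr : r.Pairwise (· ≤ ·)) :
    Knuth (r ++ [x]) ((rowInsert x r).2.toList ++ (rowInsert x r).1) := by
  induction r with
  | nil => exact .refl _
  | cons y r ih =>
    by_cases hxy : x < y
    · simpa [rowInsert, hxy] using knuth_cons_append hxy r hr
    · simp only [rowInsert, hxy, if_false]
      obtain ⟨hy, hr'⟩ := List.pairwise_cons.1 hr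
      refine ((ih hr').cons y).trans ?_
      cases hu : (rowInsert x r).2 with
      | none => exact .refl _
      | some u =>
        obtain ⟨h1, h2, h3⟩ := mem_of_bumped hu
        have h4 := pairwise_rowInsert x hr'
        have h5 := (perm_rowInsert x r).subset
        cases ht : (rowInsert x r).1 with
        | nil => simp [ht] at h3
        | cons c t =>
          rw [ht] at h3 h4 h5
          have hc : c ≤ x := by
            rcases List.mem_cons.1 h3 with rfl | h3
            exacts [le_rfl, (List.pairwise_cons.1 h4).1 x h3]
          have hyc : y ≤ c := by
            rcases List.mem_cons.1 (h5 (by simp : c ∈ _)) with rfl | h6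
            exacts [by omega, hy c h6]
          exact Knuth.triple [] t (KnuthTriple.left hyc (by omega : c < u))

theorem knuth_tableauInsert (x : ℕ) (T : List (List ℕ)) (hT : ∀ r ∈ T, r.Pairwise (· ≤ ·)) :
    Knuth (rowWord T ++ [x]) (rowWord (tableauInsert T x)) := by
  induction T generalizing x with
  | nil => exact .refl _
  | cons r T ih =>
    rw [tableauInsert_cons]
    simp only [List.forall_mem_cons] at hT
    have h := (knuth_rowInsert x r hT.1).congr (rowWord T) []
    simp only [rowWord, List.append_nil] at h ⊢
    rw [List.append_assoc]
    refine h.trans ?_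
    cases (rowInsert x r).2 with
    | none => exact .refl _
    | some u => simpa using (ih u hT.2).congr [] (rowInsert x r).1

theorem knuth_rowWord (w : List ℕ) : Knuth w (rowWord (w.foldl tableauInsert [])) := by
  induction w using List.reverseRecOn with
  | nil => exact .refl _
  | append_singleton w x ih =>
    rw [List.foldl_append]
    have := ih.congr [] [x]
    exact (by simpa using this : Knuth (w ++ [x]) _).trans
      (knuth_tableauInsert x _ (pairwise_foldl_tableauInsert w [] (by simp)))

/-- Words with the same insertion tableau are Knuth equivalent. -/
theorem knuth_of_foldl_tableauInsert_eq {v w : List ℕ}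
    (h : v.foldl tableauInsert [] = w.foldl tableauInsert []) : Knuth v w :=
  (knuth_rowWord v).trans (h ▸ (knuth_rowWord w).symm)

theorem KnuthTriple.perm {a b : List ℕ} (h : KnuthTriple a b) : a.Perm b := by
  cases h with
  | left => exact List.Perm.swap _ _ _
  | right => exact (List.Perm.swap _ _ _).cons _

theorem Knuth.perm {v w : List ℕ} (h : Knuth v w) : v.Perm w := by
  induction h with
  | triple u t h => exact (h.perm.append_left u).append_right t
  | refl w => exact .refl _
  | symm _ ih => exact ih.symm
  | trans _ _ ih ih' => exact ih.trans ih'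

/-- Complementing the letters preserves Knuth equivalence of words without repeated letters. -/
theorem Knuth.map_sub {v w : List ℕ} (h : Knuth v w) (q : ℕ) (hv : v.Nodup)
    (hq : ∀ x ∈ v, x ≤ q) : Knuth (v.map (q - ·)) (w.map (q - ·)) := by
  induction h with
  | triple u t h =>
    simp only [List.map_append]
    cases h with
    | @left x y z hxy hyz =>
      have h1 := (List.nodup_append.1 (List.nodup_append.1 hv).1).2.1
      -- The complemented relation is strict where this one is weak, which is why the letters must
      -- be distinct.
      have h2 : x ≠ y := by simp at h1; tauto
      have h3 := hq z (by simp)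
      have h4 := hq y (by simp)
      exact (Knuth.triple _ _ (KnuthTriple.left (x := q - z) (y := q - y) (z := q - x)
        (by omega) (by omega))).symm
    | @right x y z hxy hyz =>
      have h1 := (List.nodup_append.1 (List.nodup_append.1 hv).1).2.1
      have h2 : y ≠ z := by simp at h1; tauto
      have h3 := hq z (by simp)
      have h4 := hq y (by simp)
      exact (Knuth.triple _ _ (KnuthTriple.right (x := q - z) (y := q - y) (z := q - x)
        (by omega) (by omega))).symm
  | refl w => exact .refl _
  | symm h ih =>
    exact (ih (h.perm.nodup_iff.2 hv) fun x hx => hq x (h.perm.subset hx)).symm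
  | trans h h' ih ih' =>
    exact (ih hv hq).trans (ih' (h.perm.nodup_iff.1 hv) fun x hx => hq x (h.perm.symm.subset hx))

/-! ### Delaying a chain of squares -/

/-- Only a marked `y` and the unmarked `x` it is delayed past change order, and for them `y.2 ≤ x.2`
becomes strict by `ChainTo`. That weak inequality is free at label `0` and renews itself at each
marked letter, because labels along the chain rise by one. -/
theorem pairwise_good_of_newWord : ∀ (l : List (Bool × ℕ × ℕ)) {y : ℕ × ℕ} {P : ℕ},
    (newWord y l).Pairwise Good → ChainTo y l P → (∀ x ∈ newWord y l, y.1 < x.1 → y.2 ≤ x.2) →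
    (y :: l.map Prod.snd).Pairwise Good
  | [], y, P, _, _, _ => by simp
  | (false, x) :: l, y, P, hg, hch, hy => by
    simp only [newWord, List.pairwise_cons, List.forall_mem_cons] at hg hy
    have ih := List.pairwise_cons.1 (pairwise_good_of_newWord l hg.2 hch.2 hy.2)
    have hsub : ∀ {e}, e ∈ y :: l.map Prod.snd → e ∈ newWord y l :=
      fun he => (perm_newWord l y).symm.subset he
    have hxy := hg.1 y (hsub (by simp))
    simp only [List.map_cons, List.pairwise_cons, List.forall_mem_cons]
    refine ⟨⟨⟨hxy.1.symm, fun h => lt_of_le_of_ne (hy.1 h) hch.1.symm⟩, ih.1⟩,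
      fun e he => hg.1 e (hsub (by simp [he])), ih.2⟩
  | (true, z) :: l, y, P, hg, hch, hy => by
    simp only [newWord, List.pairwise_cons] at hg
    have hsub : ∀ {e}, e ∈ z :: l.map Prod.snd → e ∈ newWord z l :=
      fun he => (perm_newWord l z).symm.subset he
    have ih := pairwise_good_of_newWord l hg.2 hch.2.2 fun x hx hzx => by
      have h1 := (hg.1 x hx).2 (hch.1.trans hzx)
      have h2 := hch.2.1
      omega
    simp only [List.map_cons]
    exact List.pairwise_cons.2 ⟨fun e he => hg.1 e (hsub he), ih⟩

/-- The marked word of a list of blocks, each consisting of a marked square and the unmarked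
squares following it. -/
def blockItems (f : Square → ℕ × ℕ) (bs : List (Square × List Square)) :
    List (Bool × ℕ × ℕ) :=
  bs.flatMap fun p => (true, f p.1) :: p.2.map fun x => (false, f x)

theorem newWord_map_append (y : ℕ × ℕ) (f : Square → ℕ × ℕ) (w : List Square)
    (l : List (Bool × ℕ × ℕ)) :
    newWord y ((w.map fun x => (false, f x)) ++ l) = w.map f ++ newWord y l := by
  induction w with
  | nil => rfl
  | cons x w ih => simp [newWord, ih]

theorem chainTo_map_append (y : ℕ × ℕ) (f : Square → ℕ × ℕ) {w : List Square}
    {l : List (Bool × ℕ × ℕ)} {P : ℕ} (hw : ∀ x ∈ w, (f x).2 ≠ y.2) (h : ChainTo y l P) :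
    ChainTo y ((w.map fun x => (false, f x)) ++ l) P := by
  induction w with
  | nil => exact h
  | cons x w ih => exact ⟨hw x (by simp), ih fun z hz => hw z (by simp [hz])⟩

theorem newWord_blockItems (f : Square → ℕ × ℕ) (bs : List (Square × List Square)) :
    ∀ (s : Square) (w : List Square),
    newWord (f s) ((w.map fun x => (false, f x)) ++ blockItems f bs) =
      ((s, w) :: bs).flatMap fun p => p.2.map f ++ [f p.1] := by
  induction bs with
  | nil =>
    intro s w
    rw [newWord_map_append]
    simp [blockItems, newWord]
  | cons p bs ih =>
    intro s w
    rw [newWord_map_append]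
    have := ih p.1 p.2
    simp [blockItems, newWord] at this ⊢
    exact this

theorem map_snd_blockItems (f : Square → ℕ × ℕ) (bs : List (Square × List Square)) :
    (blockItems f bs).map Prod.snd = bs.flatMap fun p => f p.1 :: p.2.map f := by
  induction bs with
  | nil => rfl
  | cons p bs ih =>
    simp only [blockItems, List.flatMap_cons, List.map_append] at ih ⊢
    rw [ih]; simp

theorem chainTo_blockItems (f : Square → ℕ × ℕ) (bs : List (Square × List Square)) :
    ∀ (s : Square) (w : List Square) (k : ℕ),
    (∀ pre p post, (s, w) :: bs = pre ++ p :: post →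
      (f p.1).2 = k + pre.length ∧ ∀ x ∈ p.2, (f x).2 ≠ k + pre.length) →
    (((s, w) :: bs).map Prod.fst).Pairwise (fun s t => (f s).1 < (f t).1) →
    ChainTo (f s) ((w.map fun x => (false, f x)) ++ blockItems f bs) (k + bs.length) := by
  induction bs with
  | nil =>
    intro s w k h _
    obtain ⟨h1, h2⟩ := h [] (s, w) [] rfl
    simp only [List.length_nil, add_zero] at h1 h2
    exact chainTo_map_append _ f (by simpa [h1] using h2) (by simp [blockItems, ChainTo, h1])
  | cons p bs ih =>
    intro s w k h hp
    obtain ⟨h1, h2⟩ := h [] (s, w) (p :: bs) rfl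
    obtain ⟨h3, -⟩ := h [(s, w)] p bs rfl
    simp only [List.length_nil, add_zero, List.length_cons, zero_add] at h1 h2 h3
    refine chainTo_map_append _ f (by simpa [h1] using h2) ?_
    have hp' := List.pairwise_cons.1 hp
    have := ih p.1 p.2 (k + 1) (fun pre r post hr => by
      have := h ((s, w) :: pre) r post (by simp [← hr])
      simpa [Nat.add_assoc, Nat.add_comm 1] using this) hp'.2
    simp only [blockItems, List.flatMap_cons, List.cons_append, ChainTo] at this ⊢
    refine ⟨hp'.1 _ (by simp), by omega, ?_⟩
    convert this using 1
    simp; omega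

/-- Rotating the blocks of a suitably labelled word gives a Knuth equivalent word. -/
theorem knuth_blocks (ρ lab : Square → ℕ) (W : List Square) (bs : List (Square × List Square))
    (hg : ((W ++ bs.flatMap fun p => p.1 :: p.2).map fun s => (ρ s, lab s)).Pairwise Good)
    (hb : ∀ pre p post, bs = pre ++ p :: post →
      lab p.1 = pre.length ∧ ∀ x ∈ p.2, lab x ≠ pre.length)
    (hinc : (bs.map Prod.fst).Pairwise (fun s t => ρ s < ρ t))
    (hlab : ∀ x ∈ W ++ bs.flatMap fun p => p.1 :: p.2, lab x + 1 ≤ bs.length) :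
    Knuth ((W ++ bs.flatMap fun p => p.1 :: p.2).map ρ)
      ((W ++ bs.flatMap fun p => p.2 ++ [p.1]).map ρ) := by
  cases bs with
  | nil => exact .refl _
  | cons p bs =>
    obtain ⟨s, w⟩ := p
    set f : Square → ℕ × ℕ := fun s => (ρ s, lab s) with hf
    have hch := chainTo_blockItems f bs s w 0 (by simpa [hf] using hb) (by simpa [hf] using hinc)
    have e1 : (W ++ ((s, w) :: bs).flatMap fun p => p.1 :: p.2).map f = W.map f ++
        f s :: ((w.map fun x => (false, f x)) ++ blockItems f bs).map Prod.snd := by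
      simp [map_snd_blockItems, List.map_flatMap, Function.comp_def]
    have e2 : (W ++ ((s, w) :: bs).flatMap fun p => p.2 ++ [p.1]).map f = W.map f ++
        newWord (f s) ((w.map fun x => (false, f x)) ++ blockItems f bs) := by
      rw [newWord_blockItems]
      simp [List.map_flatMap]
    have e3 : ∀ L : List Square, L.map ρ = (L.map f).map Prod.fst := by
      intro L; simp [hf]
    rw [e3, e3, e1, e2]
    rw [e1] at hg
    refine knuth_of_foldl_tableauInsert_eq (foldl_tableauInsert_newWord _ _ _ _ _ le_rfl hg
      (by simpa [hf] using (hb [] (s, w) bs rfl).1) hch ?_)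
    intro e he
    have h1 : e ∈ (W ++ ((s, w) :: bs).flatMap fun p => p.1 :: p.2).map f := by
      rw [e1]
      simp only [List.mem_append, List.mem_cons] at he ⊢
      tauto
    obtain ⟨x, hx, rfl⟩ := List.mem_map.1 h1
    have := hlab x hx
    simp [hf] at this ⊢
    omega

/-- A left shift starts from the delayed word, so monotonicity is available there and must first be
transferred to the advanced word. -/
theorem knuth_blocks' (ρ lab : Square → ℕ) (bs : List (Square × List Square))
    (hg : ((bs.flatMap fun p => p.2 ++ [p.1]).map fun s => (ρ s, lab s)).Pairwise Good)
    (hb : ∀ pre p post, bs = pre ++ p :: post →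
      lab p.1 = pre.length ∧ ∀ x ∈ p.2, lab x ≠ pre.length)
    (hinc : (bs.map Prod.fst).Pairwise (fun s t => ρ s < ρ t))
    (hlab : ∀ x ∈ bs.flatMap fun p => p.2 ++ [p.1], lab x + 1 ≤ bs.length) :
    Knuth ((bs.flatMap fun p => p.2 ++ [p.1]).map ρ)
      ((bs.flatMap fun p => p.1 :: p.2).map ρ) := by
  refine (knuth_blocks ρ lab [] bs ?_ hb hinc fun x hx => hlab x ?_).symm
  · cases bs with
    | nil => simp
    | cons p bs =>
      obtain ⟨s, w⟩ := p
      set f : Square → ℕ × ℕ := fun s => (ρ s, lab s) with hf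
      have hch := chainTo_blockItems f bs s w 0 (by simpa [hf] using hb) (by simpa [hf] using hinc)
      have e1 : (((s, w) :: bs).flatMap fun p => p.1 :: p.2).map f =
          f s :: ((w.map fun x => (false, f x)) ++ blockItems f bs).map Prod.snd := by
        simp [map_snd_blockItems, List.map_flatMap, Function.comp_def]
      have e2 : (((s, w) :: bs).flatMap fun p => p.2 ++ [p.1]).map f =
          newWord (f s) ((w.map fun x => (false, f x)) ++ blockItems f bs) := by
        rw [newWord_blockItems]
        simp [List.map_flatMap]
      rw [e2] at hg
      rw [List.nil_append, e1]
      refine pairwise_good_of_newWord _ hg hch fun x _ _ => ?_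
      have := (hb [] (s, w) bs rfl).1
      simp only [hf, List.length_nil] at this ⊢
      omega
  · simp only [List.nil_append, List.mem_flatMap, List.mem_cons, List.mem_append] at hx ⊢
    obtain ⟨p, hp, h⟩ := hx
    exact ⟨p, hp, by tauto⟩

/-! ### Labels from longest chains -/

/-- The square `s` lies to the left of `t` and has a smaller value of `ρ`. -/
def Before (ρ : Square → ℕ) (s t : Square) : Prop := s.1 < t.1 ∧ ρ s < ρ t

/-- `T` is a sequence of members of `L` along which the column and `ρ` increase. -/
def IsChainIn (ρ : Square → ℕ) (L T : List Square) : Prop :=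
  (∀ s ∈ T, s ∈ L) ∧ T.Pairwise (Before ρ)

theorem Before.trans {ρ : Square → ℕ} {s t u : Square} (h : Before ρ s t) (h' : Before ρ t u) :
    Before ρ s u :=
  ⟨h.1.trans h'.1, h.2.trans h'.2⟩

/-- The maximal length of a sequence with the property `C`. -/
noncomputable def maxLen (C : List Square → Prop) : ℕ := sSup {n | ∃ T, C T ∧ T.length = n}

theorem le_maxLen {C : List Square → Prop} {k : ℕ} (hk : ∀ T, C T → T.length ≤ k)
    {T : List Square} (hT : C T) : T.length ≤ maxLen C :=
  le_csSup ⟨k, by rintro _ ⟨T, h, rfl⟩; exact hk T h⟩ ⟨T, hT, rfl⟩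

theorem exists_maxLen {C : List Square → Prop} {k : ℕ} (hk : ∀ T, C T → T.length ≤ k)
    (hC : ∃ T, C T) : ∃ T, C T ∧ T.length = maxLen C := by
  obtain ⟨T, hT⟩ := hC
  exact Nat.sSup_mem (s := {n | ∃ T, C T ∧ T.length = n}) ⟨_, T, hT, rfl⟩
    ⟨k, by rintro _ ⟨T, h, rfl⟩; exact hk T h⟩

section

variable {ρ : Square → ℕ} {L S : List Square}

theorem IsChainIn.append {T U : List Square} {x : Square} (h : IsChainIn ρ L (T ++ [x]))
    (h' : IsChainIn ρ L (x :: U)) : IsChainIn ρ L (T ++ x :: U) := by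
  refine ⟨fun s hs => ?_, ?_⟩
  · rcases List.mem_append.1 hs with hs | hs
    exacts [h.1 s (by simp [hs]), h'.1 s hs]
  · have h1 := List.pairwise_append.1 h.2
    refine List.pairwise_append.2 ⟨h1.1, h'.2, fun s hs t ht => ?_⟩
    have h2 := h1.2.2 s hs x (by simp)
    rcases List.mem_cons.1 ht with rfl | ht
    exacts [h2, h2.trans ((List.pairwise_cons.1 h'.2).1 t ht)]

theorem IsChainIn.sublist {T U : List Square} (h : IsChainIn ρ L U) (hT : T.Sublist U) :
    IsChainIn ρ L T :=
  ⟨fun s hs => h.1 s (hT.subset hs), h.2.sublist hT⟩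

theorem isChainIn_pair {x y : Square} (hx : x ∈ L) (hy : y ∈ L) (h : Before ρ x y) :
    IsChainIn ρ L [x, y] :=
  ⟨by simp [hx, hy], by simp [h]⟩

/-- Follow both chains to the first position where the competing member `e` lies below the member
`f` of `S`; `x` below `s` guarantees one. If an earlier member of `S` is not to the left of `e`,
then `e` precedes `f`, and the competing chain up to `e` followed by `S` from `f` is longer than
`S`. Otherwise `S` can switch to the competing chain at `e` and becomes lexicographically smaller.
-/
theorem not_crossing (hlong : ∀ T, IsChainIn ρ L T → T.length ≤ S.length)
    (hlex : ∀ Z f F e E, S = Z ++ f :: F → IsChainIn ρ L (Z ++ e :: E) → E.length = F.length →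
      ρ f ≤ ρ e) (hS : IsChainIn ρ L S) {x s : Square} {U : List Square} (hxs : ρ x < ρ s) :
    ∀ (E F Ze Zf : List Square), S = Zf ++ (F ++ s :: U) →
      IsChainIn ρ L (Ze ++ (E ++ x :: U)) → E.length = F.length → Ze.length = Zf.length →
      (∀ z ∈ Zf, ∀ e ∈ E ++ x :: U, ρ z < ρ e) → False := by
  have key : ∀ (Ze Zf E F : List Square) (e f : Square), S = Zf ++ f :: F →
      IsChainIn ρ L (Ze ++ e :: E) → E.length = F.length → Ze.length = Zf.length →
      (∀ z ∈ Zf, ∀ t ∈ e :: E, ρ z < ρ t) → ρ e < ρ f → False := by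
    intro Ze Zf E F e f hSf hE hlen hlenZ hz hef
    rw [hSf] at hS
    have hS' := List.pairwise_append.1 hS.2
    have hE' := List.pairwise_append.1 hE.2
    have hcol : ∀ z ∈ Zf, z.1 < e.1 := by
      intro z hzZ
      by_contra hlt
      have hzf := (hS'.2.2 z hzZ f (by simp)).1
      have h1 : IsChainIn ρ L (e :: f :: F) := IsChainIn.append (T := [e])
        (isChainIn_pair (hE.1 e (by simp)) (hS.1 f (by simp)) ⟨by omega, hef⟩)
        (hS.sublist (List.sublist_append_right _ _))
      have h2 := hlong _ (IsChainIn.append (T := Ze) (hE.sublist (by simp)) h1)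
      simp [hSf] at h2
      omega
    have h1 : IsChainIn ρ L (Zf ++ e :: E) := by
      refine ⟨fun t ht => ?_, List.pairwise_append.2 ⟨hS'.1, hE'.2.1, fun z hzZ t ht =>
        ⟨?_, hz z hzZ t ht⟩⟩⟩
      · rcases List.mem_append.1 ht with ht | ht
        exacts [hS.1 t (by simp [ht]), hE.1 t (List.mem_append_right _ ht)]
      · rcases List.mem_cons.1 ht with rfl | ht
        exacts [hcol z hzZ, (hcol z hzZ).trans ((List.pairwise_cons.1 hE'.2.1).1 t ht).1]
    have := hlex Zf f F e E hSf h1 hlen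
    omega
  intro E
  induction E with
  | nil =>
    intro F Ze Zf hSf hE hlen hlenZ hz
    obtain rfl : F = [] := List.length_eq_zero_iff.1 (by simpa using hlen.symm)
    exact key Ze Zf U U x s hSf hE rfl hlenZ hz hxs
  | cons e E ih =>
    intro F Ze Zf hSf hE hlen hlenZ hz
    cases F with
    | nil => simp at hlen
    | cons f F =>
      rcases lt_or_ge (ρ e) (ρ f) with h | h
      · exact key Ze Zf (E ++ x :: U) (F ++ s :: U) e f hSf hE (by simpa using hlen) hlenZ hz h
      · refine ih F (Ze ++ [e]) (Zf ++ [f]) (by simp [hSf]) (by simpa using hE)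
          (by simpa using hlen) (by simpa using hlenZ) ?_
        intro z hzZ t ht
        rcases List.mem_append.1 hzZ with hzZ | hzZ
        · exact hz z hzZ t (List.mem_cons_of_mem _ ht)
        · rw [List.mem_singleton] at hzZ
          subst hzZ
          have hE' := (List.pairwise_append.1 hE.2).2.1
          exact h.trans_lt ((List.pairwise_cons.1 hE').1 t ht).2

/-- Delaying the pointwise smallest longest chain gives a Knuth equivalent word. -/
theorem knuth_of_smallest (W : List Square) (bs : List (Square × List Square))
    (hLdef : L = W ++ bs.flatMap fun p => p.1 :: p.2) (hSdef : S = bs.map Prod.fst)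
    (hcol : L.Pairwise fun s t => s.1 < t.1) (hρ : (L.map ρ).Nodup)
    (hS : IsChainIn ρ L S) (hlong : ∀ T, IsChainIn ρ L T → T.length ≤ S.length)
    (hlex : ∀ Z f F e E, S = Z ++ f :: F → IsChainIn ρ L (Z ++ e :: E) → E.length = F.length →
      ρ f ≤ ρ e) :
    Knuth (L.map ρ) ((W ++ bs.flatMap fun p => p.2 ++ [p.1]).map ρ) := by
  -- The number of letters before `x` in a longest chain ending at `x`, so that `S` carries the
  -- labels `0, 1, …`.
  set lab : Square → ℕ := fun x => maxLen fun T => IsChainIn ρ L (T ++ [x]) with hlab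
  have hbd : ∀ x T, IsChainIn ρ L (T ++ [x]) → T.length ≤ S.length := fun x T hT => by
    have := hlong _ hT
    simp at this; omega
  have hex : ∀ x ∈ L, ∃ T, IsChainIn ρ L (T ++ [x]) ∧ T.length = lab x := fun x hx =>
    exists_maxLen (hbd x) ⟨[], by simpa [IsChainIn] using hx⟩
  have hle : ∀ x T, IsChainIn ρ L (T ++ [x]) → T.length ≤ lab x := fun x T hT =>
    le_maxLen (hbd x) hT
  have hmono : ∀ x ∈ L, ∀ y ∈ L, Before ρ x y → lab x < lab y := by
    intro x hx y hy hxy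
    obtain ⟨T, hT, hTl⟩ := hex x hx
    have := hle y (T ++ [x]) (by simpa using hT.append (isChainIn_pair hx hy hxy))
    simp at this; omega
  have hSlab : ∀ S₁ s S₂, S = S₁ ++ s :: S₂ → lab s = S₁.length := by
    intro S₁ s S₂ h
    rw [h] at hS
    refine le_antisymm ?_ (hle s S₁ (hS.sublist (by simp)))
    obtain ⟨T, hT, hTl⟩ := hex s (hS.1 s (by simp))
    have := hlong _ (hT.append (hS.sublist (List.sublist_append_right _ _)))
    simp [h] at this; omega
  have hlen : bs.length = S.length := by simp [hSdef]
  rw [hLdef]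
  refine knuth_blocks ρ lab W bs ?_ ?_ ?_ ?_
  · rw [← hLdef]
    refine pairwise_good (by simpa [Function.comp_def] using hρ) ?_
    exact List.pairwise_map.2 (hcol.imp_of_mem fun {s t} hs ht h h' => hmono s hs t ht ⟨h, h'⟩)
  · intro pre p post hbs
    have hSp : S = pre.map Prod.fst ++ p.1 :: post.map Prod.fst := by simp [hSdef, hbs]
    refine ⟨by simpa using hSlab _ _ _ hSp, fun x hx hxl => ?_⟩
    have hLp : L = (W ++ pre.flatMap fun p => p.1 :: p.2) ++
        (p.1 :: p.2 ++ post.flatMap fun p => p.1 :: p.2) := by simp [hLdef, hbs]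
    have hxL : x ∈ L := by rw [hLp]; simp [hx]
    have hpL : p.1 ∈ L := by rw [hLp]; simp
    have hc := hcol
    rw [hLp] at hc
    have hc1 := List.pairwise_append.1 (List.pairwise_append.1 hc).2.1
    have hpx : p.1.1 < x.1 := (List.pairwise_cons.1 hc1.1).1 x hx
    have hxpost : ∀ t ∈ post.map Prod.fst, x.1 < t.1 := by
      intro t ht
      obtain ⟨r, hr, rfl⟩ := List.mem_map.1 ht
      exact hc1.2.2 x (by simp [hx]) r.1 (List.mem_flatMap.2 ⟨r, hr, by simp⟩)
    -- A higher `x` to the right of `p.1` would have a larger label.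
    have hlt : ρ x < ρ p.1 := by
      by_contra hge
      rcases (not_lt.1 hge).lt_or_eq with h | h
      · have := hmono _ hpL _ hxL ⟨hpx, h⟩
        have := hSlab _ _ _ hSp
        simp at this; omega
      · have := List.inj_on_of_nodup_map hρ hpL hxL h
        rw [this] at hpx
        exact lt_irrefl _ hpx
    obtain ⟨T, hT, hTl⟩ := hex x hxL
    have hS' := hS
    rw [hSp] at hS'
    have hS'' := List.pairwise_cons.1 (List.pairwise_append.1 hS'.2).2.1
    have hxU : IsChainIn ρ L (x :: post.map Prod.fst) := by
      refine ⟨?_, List.pairwise_cons.2 ⟨fun t ht => ⟨hxpost t ht, hlt.trans (hS''.1 t ht).2⟩,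
        hS''.2⟩⟩
      intro t ht
      rcases List.mem_cons.1 ht with rfl | ht
      exacts [hxL, hS'.1 t (by simp only [List.mem_append, List.mem_cons]; tauto)]
    -- A longest chain up to `x`, continued by the part of `S` after `p.1`, has the length of `S`
    -- and is lower at the position of `p.1`.
    exact not_crossing hlong hlex hS hlt T (pre.map Prod.fst) [] [] (by simpa using hSp)
      (by simpa using hT.append hxU) (by simp [hTl, hxl]) rfl (by simp)
  · rw [← hSdef]
    exact hS.2.imp fun h => h.2
  · rw [← hLdef, hlen]
    intro x hx
    obtain ⟨T, hT, hTl⟩ := hex x hx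
    have := hlong _ hT
    simp at this; omega

/-- Advancing the pointwise largest longest chain gives a Knuth equivalent word. -/
theorem knuth_of_largest (W : List Square) (bs : List (Square × List Square))
    (hLdef : L = (bs.flatMap fun p => p.2 ++ [p.1]) ++ W) (hSdef : S = bs.map Prod.fst)
    (hcol : L.Pairwise fun s t => s.1 < t.1) (hρ : (L.map ρ).Nodup)
    (hS : IsChainIn ρ L S) (hlong : ∀ T, IsChainIn ρ L T → T.length ≤ S.length)
    (hlex : ∀ Z f F e E, S = Z ++ f :: F → IsChainIn ρ L (Z ++ e :: E) → E.length = F.length →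
      ρ e ≤ ρ f) :
    Knuth (L.map ρ) (((bs.flatMap fun p => p.1 :: p.2) ++ W).map ρ) := by
  -- Counting from the right makes the competing chain share its initial part with `S`, so
  -- lexicographic maximality applies at once and no analogue of `not_crossing` is needed.
  set m : Square → ℕ := fun x => maxLen fun T => IsChainIn ρ L (x :: T) with hm
  have hbd : ∀ x T, IsChainIn ρ L (x :: T) → T.length ≤ S.length := fun x T hT => by
    have := hlong _ hT
    simp at this; omega
  have hex : ∀ x ∈ L, ∃ T, IsChainIn ρ L (x :: T) ∧ T.length = m x := fun x hx =>
    exists_maxLen (hbd x) ⟨[], by simpa [IsChainIn] using hx⟩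
  have hle : ∀ x T, IsChainIn ρ L (x :: T) → T.length ≤ m x := fun x T hT =>
    le_maxLen (hbd x) hT
  have hmk : ∀ x ∈ L, m x + 1 ≤ S.length := by
    intro x hx
    obtain ⟨T, hT, hTl⟩ := hex x hx
    have := hlong _ hT
    simp at this; omega
  have hmono : ∀ x ∈ L, ∀ y ∈ L, Before ρ x y → m y < m x := by
    intro x hx y hy hxy
    obtain ⟨T, hT, hTl⟩ := hex y hy
    have := hle x (y :: T) (IsChainIn.append (T := [x]) (isChainIn_pair hx hy hxy) hT)
    simp at this; omega
  have hSm : ∀ S₁ s S₂, S = S₁ ++ s :: S₂ → m s = S₂.length := by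
    intro S₁ s S₂ h
    rw [h] at hS
    refine le_antisymm ?_ (hle s S₂ (hS.sublist (by simp)))
    obtain ⟨T, hT, hTl⟩ := hex s (hS.1 s (by simp))
    have := hlong _ (IsChainIn.append (T := S₁) (hS.sublist (by simp)) hT)
    simp [h] at this; omega
  have hlen : bs.length = S.length := by simp [hSdef]
  have hsubl : (bs.flatMap fun p => p.2 ++ [p.1]).Sublist L := by simp [hLdef]
  have hK : Knuth ((bs.flatMap fun p => p.2 ++ [p.1]).map ρ)
      ((bs.flatMap fun p => p.1 :: p.2).map ρ) := by
    -- The count is reversed so that labels increase along chains and start at `0` on `S`; `hmk`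
    -- rules out truncation.
    refine knuth_blocks' ρ (fun x => S.length - 1 - m x) bs ?_ ?_ ?_ ?_
    · refine pairwise_good (by
        simpa [Function.comp_def] using hρ.sublist (hsubl.map ρ)) ?_
      refine List.pairwise_map.2 ((hcol.sublist hsubl).imp_of_mem fun {s t} hs ht h h' => ?_)
      have h1 := hmono s (hsubl.subset hs) t (hsubl.subset ht) ⟨h, h'⟩
      have h2 := hmk s (hsubl.subset hs)
      omega
    · intro pre p post hbs
      have hSp : S = pre.map Prod.fst ++ p.1 :: post.map Prod.fst := by simp [hSdef, hbs]
      have hSlen : S.length = pre.length + (post.length + 1) := by simp [hSp]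
      have hmp : m p.1 = post.length := by simpa using hSm _ _ _ hSp
      refine ⟨by omega, fun x hx hxl => ?_⟩
      have hLp : L = (pre.flatMap fun p => p.2 ++ [p.1]) ++
          (p.2 ++ p.1 :: ((post.flatMap fun p => p.2 ++ [p.1]) ++ W)) := by simp [hLdef, hbs]
      have hxL : x ∈ L := by rw [hLp]; simp [hx]
      have hpL : p.1 ∈ L := by rw [hLp]; simp
      have hc := hcol
      rw [hLp] at hc
      have hc0 := List.pairwise_append.1 hc
      have hc1 := List.pairwise_append.1 hc0.2.1
      have hpx : x.1 < p.1.1 := hc1.2.2 x hx p.1 (by simp)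
      have hxpre : ∀ t ∈ pre.map Prod.fst, t.1 < x.1 := by
        intro t ht
        obtain ⟨r, hr, rfl⟩ := List.mem_map.1 ht
        exact hc0.2.2 r.1 (List.mem_flatMap.2 ⟨r, hr, by simp⟩) x (by simp [hx])
      have hmx : m x = post.length := by
        have := hmk x hxL
        omega
      have hlt : ρ p.1 < ρ x := by
        by_contra hge
        rcases (not_lt.1 hge).lt_or_eq with h | h
        · have := hmono _ hxL _ hpL ⟨hpx, h⟩
          omega
        · have := List.inj_on_of_nodup_map hρ hxL hpL h
          rw [this] at hpx
          exact lt_irrefl _ hpx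
      obtain ⟨T, hT, hTl⟩ := hex x hxL
      have hS' := hS
      rw [hSp] at hS'
      have hS'' := List.pairwise_append.1 hS'.2
      have hxU : IsChainIn ρ L (pre.map Prod.fst ++ [x]) := by
        refine ⟨?_, List.pairwise_append.2 ⟨hS''.1, by simp, fun t ht u hu => ?_⟩⟩
        · intro t ht
          rcases List.mem_append.1 ht with ht | ht
          · exact hS'.1 t (by simp only [List.mem_append]; tauto)
          · rw [List.mem_singleton.1 ht]; exact hxL
        · rw [List.mem_singleton.1 hu]
          exact ⟨hxpre t ht, (hS''.2.2 t ht p.1 (by simp)).2.trans hlt⟩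
      have := hlex _ _ _ _ _ hSp (hxU.append hT) (by simp [hTl, hmx])
      omega
    · rw [← hSdef]
      exact hS.2.imp fun h => h.2
    · rw [hlen]
      intro x hx
      have := hmk x (hsubl.subset hx)
      omega
  have := hK.congr [] (W.map ρ)
  rw [hLdef]
  simpa using this

end

/-! ### Words of placements -/

theorem nodup_of_pairwise_fst {L : List Square} (hL : L.Pairwise fun s t => s.1 < t.1) :
    L.Nodup :=
  hL.imp fun h h' => by rw [h'] at h; exact lt_irrefl _ h

theorem word_toFinset {L : List Square} (hL : L.Pairwise fun s t => s.1 < t.1) :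
    word L.toFinset = L.map Prod.snd := by
  have hn := nodup_of_pairwise_fst hL
  have h1 : L.toFinset.map toLex.toEmbedding = (L.map toLex).toFinset := by
    ext x
    simp only [Finset.mem_map, List.mem_toFinset, List.mem_map]
    rfl
  have h2 : ((L.map toLex).toFinset).sort (· ≤ ·) = L.map toLex := by
    rw [List.toFinset_sort _ (hn.map toLex.injective)]
    exact List.pairwise_map.2 (hL.imp fun h => Prod.Lex.le_iff.2 (Or.inl h))
  rw [word, h1, h2]
  simp

theorem exists_list_of_placement (P : Finset Square)
    (hP : ∀ s ∈ P, ∀ t ∈ P, s.1 = t.1 → s = t) :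
    ∃ L : List Square, L.Pairwise (fun s t => s.1 < t.1) ∧ L.toFinset = P := by
  refine ⟨((P.map toLex.toEmbedding).sort (· ≤ ·)).map ofLex, ?_, by ext x; simp⟩
  refine List.pairwise_map.2 ?_
  have h := (Finset.pairwise_sort (P.map toLex.toEmbedding) (· ≤ ·)).and
    (Finset.sort_nodup (P.map toLex.toEmbedding) (· ≤ ·))
  refine h.imp_of_mem fun {s t} hs ht hst => ?_
  rcases Prod.Lex.le_iff.1 hst.1 with h' | ⟨h', -⟩
  · exact h'
  · refine absurd (ofLex.injective (hP _ ?_ _ ?_ h')) hst.2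
    · simpa using hs
    · simpa using ht

theorem exists_split_fst (c : ℕ) (L : List Square) (hL : L.Pairwise fun s t => s.1 < t.1) :
    ∃ A B, L = A ++ B ∧ (∀ s ∈ A, s.1 < c) ∧ ∀ s ∈ B, c ≤ s.1 := by
  induction L with
  | nil => exact ⟨[], [], by simp⟩
  | cons x L ih =>
    obtain ⟨hx, hL⟩ := List.pairwise_cons.1 hL
    rcases lt_or_ge x.1 c with h | h
    · obtain ⟨A, B, rfl, hA, hB⟩ := ih hL
      exact ⟨x :: A, B, rfl, by simpa [h] using hA, hB⟩
    · refine ⟨[], x :: L, rfl, by simp, ?_⟩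
      intro s hs
      rcases List.mem_cons.1 hs with rfl | hs
      exacts [h, h.trans (hx s hs).le]

theorem exists_window (L : List Square) (hL : L.Pairwise fun s t => s.1 < t.1) (a b : ℕ) :
    ∃ A V B, L = A ++ V ++ B ∧ (∀ s ∈ A, s.1 < a) ∧ (∀ s ∈ B, b < s.1) ∧
      ∀ s, s ∈ V ↔ s ∈ L ∧ a ≤ s.1 ∧ s.1 ≤ b := by
  obtain ⟨A, L', rfl, hA, hL'⟩ := exists_split_fst a L hL
  obtain ⟨V, B, rfl, hV, hB⟩ := exists_split_fst (b + 1) L' (List.pairwise_append.1 hL).2.1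
  refine ⟨A, V, B, by simp, hA, fun s hs => hB s hs, fun s => ⟨fun hs => ?_, fun hs => ?_⟩⟩
  · have := hV s hs
    exact ⟨by simp [hs], hL' s (by simp [hs]), by omega⟩
  · obtain ⟨h1, h2, h3⟩ := hs
    rcases List.mem_append.1 h1 with h | h
    · have := hA s h; omega
    · rcases List.mem_append.1 h with h | h
      · exact h
      · have := hB s h; omega

theorem sublist_of_subset {S L : List Square} (hS : S.Pairwise fun s t => s.1 < t.1)
    (hL : L.Pairwise fun s t => s.1 < t.1) (h : ∀ s ∈ S, s ∈ L) : S.Sublist L := by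
  induction L generalizing S with
  | nil =>
    cases S with
    | nil => simp
    | cons s S => simpa using h s (by simp)
  | cons x L ih =>
    obtain ⟨hx, hL'⟩ := List.pairwise_cons.1 hL
    cases S with
    | nil => simp
    | cons s S =>
      obtain ⟨hs, hS'⟩ := List.pairwise_cons.1 hS
      rcases List.mem_cons.1 (h s (by simp)) with rfl | hsL
      · refine (ih hS' hL' fun t ht => ?_).cons_cons _
        rcases List.mem_cons.1 (h t (by simp [ht])) with rfl | h'
        · exact absurd (hs _ ht) (lt_irrefl _)
        · exact h'
      · refine (ih hS hL' fun t ht => ?_).cons _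
        rcases List.mem_cons.1 (h t ht) with rfl | h'
        · rcases List.mem_cons.1 ht with rfl | ht
          · exact hsL
          · have h1 := hs _ ht
            have h2 := hx _ hsL
            omega
        · exact h'

/-! ### Cutting the window into blocks and moving the marked squares -/

theorem exists_blocks_right {S L : List Square} (h : S.Sublist L) :
    ∃ (W : List Square) (bs : List (Square × List Square)),
      L = W ++ (bs.flatMap fun p => p.1 :: p.2) ∧ S = bs.map Prod.fst := by
  induction h with
  | slnil => exact ⟨[], [], by simp⟩
  | cons x _ ih =>
    obtain ⟨W, bs, rfl, rfl⟩ := ih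
    exact ⟨x :: W, bs, by simp⟩
  | cons_cons x _ ih =>
    obtain ⟨W, bs, rfl, rfl⟩ := ih
    exact ⟨[], (x, W) :: bs, by simp⟩

theorem exists_blocks_left {S L : List Square} (h : S.Sublist L) :
    ∃ (W : List Square) (bs : List (Square × List Square)),
      L = (bs.flatMap fun p => p.2 ++ [p.1]) ++ W ∧ S = bs.map Prod.fst := by
  induction h with
  | slnil => exact ⟨[], [], by simp⟩
  | cons x _ ih =>
    obtain ⟨W, bs, rfl, rfl⟩ := ih
    cases bs with
    | nil => exact ⟨x :: W, [], by simp⟩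
    | cons p bs => exact ⟨W, (p.1, x :: p.2) :: bs, by simp⟩
  | cons_cons x _ ih =>
    obtain ⟨W, bs, rfl, rfl⟩ := ih
    exact ⟨W, (x, []) :: bs, by simp⟩

/-- The squares of the blocks after the marked squares have moved to the right. -/
def rightBlocks (b : ℕ) : List (Square × List Square) → List Square
  | [] => []
  | p :: bs => p.2 ++ ((bs.head?.map fun r => r.1.1).getD b, p.1.2) :: rightBlocks b bs

/-- The squares of the blocks after the marked squares have moved to the left. -/
def leftBlocks : ℕ → List (Square × List Square) → List Square
  | _, [] => []
  | c, p :: bs => (c, p.1.2) :: p.2 ++ leftBlocks p.1.1 bs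

theorem map_snd_rightBlocks (b : ℕ) (bs : List (Square × List Square)) :
    (rightBlocks b bs).map Prod.snd = (bs.flatMap fun p => p.2 ++ [p.1]).map Prod.snd := by
  induction bs with
  | nil => rfl
  | cons p bs ih => simp [rightBlocks, ih]

theorem map_snd_leftBlocks (bs : List (Square × List Square)) : ∀ c,
    (leftBlocks c bs).map Prod.snd = (bs.flatMap fun p => p.1 :: p.2).map Prod.snd := by
  induction bs with
  | nil => intro c; rfl
  | cons p bs ih => intro c; simp [leftBlocks, ih]

/-- Column `b` is filled and the first marked column vacated; the other columns keep their places in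
the list, so the moved squares are already listed by column. -/
theorem map_fst_rightBlocks (b : ℕ) (bs : List (Square × List Square)) :
    (bs.head?.map fun r => r.1.1).getD b :: (rightBlocks b bs).map Prod.fst =
      (bs.flatMap fun p => p.1 :: p.2).map Prod.fst ++ [b] := by
  induction bs with
  | nil => rfl
  | cons p bs ih => simp [rightBlocks, ih]

/-- Mirror image: `c` is filled and the last marked column is vacated. -/
theorem map_fst_leftBlocks (bs : List (Square × List Square)) : ∀ c,
    ((leftBlocks c bs).map Prod.fst).Sublist
      (c :: (bs.flatMap fun p => p.2 ++ [p.1]).map Prod.fst) := by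
  induction bs with
  | nil => intro c; simp [leftBlocks]
  | cons p bs ih => intro c; simpa [leftBlocks] using ih p.1.1

theorem mem_rightBlocks (b : ℕ) (x : Square) (bs : List (Square × List Square)) :
    x ∈ rightBlocks b bs ↔ x ∈ bs.flatMap Prod.snd ∨
      x ∈ List.zip (((bs.map Prod.fst).map Prod.fst).tail ++ [b]) ((bs.map Prod.fst).map Prod.snd) := by
  induction bs with
  | nil => simp [rightBlocks]
  | cons p bs ih =>
    rw [rightBlocks, List.mem_append, List.mem_cons, ih]
    cases bs with
    | nil => simp
    | cons r bs =>
      simp only [List.flatMap_cons, List.map_cons, List.tail_cons, List.cons_append,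
        List.zip_cons_cons, List.mem_append, List.mem_cons, List.head?_cons, Option.map_some,
        Option.getD_some]
      tauto

theorem mem_leftBlocks (x : Square) (bs : List (Square × List Square)) : ∀ c,
    x ∈ leftBlocks c bs ↔ x ∈ bs.flatMap Prod.snd ∨
      x ∈ List.zip (c :: (bs.map Prod.fst).map Prod.fst) ((bs.map Prod.fst).map Prod.snd) := by
  induction bs with
  | nil => intro c; simp [leftBlocks]
  | cons p bs ih =>
    intro c
    rw [leftBlocks, List.cons_append, List.mem_cons, List.mem_append, ih]
    simp only [List.flatMap_cons, List.map_cons, List.zip_cons_cons, List.mem_append,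
      List.mem_cons]
    tauto

theorem mem_sdiff_toFinset {L S R : List Square} (hL : L.Nodup) (h : L.Perm (S ++ R)) (x : Square) :
    x ∈ L.toFinset \ S.toFinset ↔ x ∈ R := by
  have h1 := List.nodup_append.1 (h.nodup_iff.1 hL)
  have h2 : x ∈ L ↔ x ∈ S ++ R := h.mem_iff
  rw [Finset.mem_sdiff, List.mem_toFinset, List.mem_toFinset, h2, List.mem_append]
  constructor
  · tauto
  · exact fun hx => ⟨Or.inr hx, fun hS => h1.2.2 x hS x hx rfl⟩

theorem perm_blocks_right (bs : List (Square × List Square)) :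
    (bs.flatMap fun p => p.1 :: p.2).Perm (bs.map Prod.fst ++ bs.flatMap Prod.snd) := by
  induction bs with
  | nil => simp
  | cons p bs ih =>
    simp only [List.flatMap_cons, List.map_cons, List.cons_append]
    refine List.Perm.cons _ ((ih.append_left _).trans ?_)
    rw [← List.append_assoc, ← List.append_assoc]
    exact List.perm_append_comm.append_right _

theorem perm_blocks_left (bs : List (Square × List Square)) :
    (bs.flatMap fun p => p.2 ++ [p.1]).Perm (bs.map Prod.fst ++ bs.flatMap Prod.snd) := by
  refine List.Perm.trans ?_ (perm_blocks_right bs)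
  induction bs with
  | nil => simp
  | cons p bs ih =>
    simp only [List.flatMap_cons]
    exact (List.perm_append_comm (l₂ := [p.1])).append ih

/-! ### Invariance of the tableau under one shift -/

/-- The hypotheses under which shifting the sequence `S` in the columns `a, …, b` is considered;
`g` is an injective relabelling of the rows. -/
structure IsWindowChain (P : Finset Square) (g : ℕ → ℕ) (a b : ℕ) (S : List Square) : Prop where
  mem : ∀ s ∈ S, s ∈ P ∧ a ≤ s.1 ∧ s.1 ≤ b
  chain : S.Pairwise (Before fun s => g s.2)
  longest : ∀ T : List Square, (∀ s ∈ T, s ∈ P ∧ a ≤ s.1 ∧ s.1 ≤ b) →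
    T.Pairwise (Before fun s => g s.2) → T.length ≤ S.length
  col_inj : ∀ s ∈ P, ∀ t ∈ P, s.1 = t.1 → s = t
  inj : ∀ s ∈ P, ∀ t ∈ P, g s.2 = g t.2 → s = t
  knuth : ∀ v w : List ℕ, (∀ x ∈ v, ∃ s ∈ P, s.2 = x) → v.Nodup →
    (∀ x ∈ w, ∃ s ∈ P, s.2 = x) → Knuth (v.map g) (w.map g) → Knuth v w

/-- The shifted squares remain sorted by column when listed blockwise, so their word can be read
off. `knuth_of_smallest` treats the window and congruence its surroundings. -/
theorem ins_rightShift {P : Finset Square} {g : ℕ → ℕ} {a b : ℕ} {S : List Square}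
    (h : IsWindowChain P g a b S) (hab : a ≤ b) (hempty : EmptyColumn P b)
    (hlex : ∀ Z f F e E, S = Z ++ f :: F → (∀ s ∈ Z ++ e :: E, s ∈ P ∧ a ≤ s.1 ∧ s.1 ≤ b) →
      (Z ++ e :: E).Pairwise (Before fun s => g s.2) → E.length = F.length → g f.2 ≤ g e.2) :
    ins P = ins (rightShift P S b) := by
  obtain ⟨L, hL, rfl⟩ := exists_list_of_placement P h.col_inj
  obtain ⟨A, V, B, rfl, hA, hB, hV⟩ := exists_window L hL a b
  simp only [List.mem_toFinset] at h hlex hempty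
  have hVcol := (List.pairwise_append.1 (List.pairwise_append.1 hL).1).2.1
  have hmem : ∀ {s}, s ∈ V ↔ s ∈ (A ++ V ++ B).toFinset ∧ a ≤ s.1 ∧ s.1 ≤ b := by
    intro s; rw [List.mem_toFinset]; exact hV s
  have hsub : S.Sublist V :=
    sublist_of_subset (h.chain.imp fun h => h.1) hVcol fun s hs => hmem.2 (h.mem s hs)
  obtain ⟨W, bs, hVdef, hSdef⟩ := exists_blocks_right hsub
  have hnodup : (V.map fun s => g s.2).Nodup :=
    List.Nodup.map_on (fun s hs t ht => h.inj s (hmem.1 hs).1 t (hmem.1 ht).1)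
      (nodup_of_pairwise_fst hVcol)
  have hK := knuth_of_smallest (ρ := fun s => g s.2) W bs hVdef hSdef hVcol hnodup
    ⟨fun s hs => hmem.2 (h.mem s hs), h.chain⟩
    (fun T hT => h.longest T (fun s hs => hmem.1 (hT.1 s hs)) hT.2)
    (fun Z f F e E hZ hE hlen => hlex Z f F e E hZ (fun s hs => (hV s).1 (hE.1 s hs)) hE.2 hlen)
  have hQ : rightShift (A ++ V ++ B).toFinset S b =
      (A ++ (W ++ rightBlocks b bs) ++ B).toFinset := by
    ext x
    have hperm : (A ++ V ++ B).Perm (S ++ (A ++ (W ++ bs.flatMap Prod.snd) ++ B)) := by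
      have h1 := perm_blocks_right bs
      rw [← hSdef] at h1
      rw [hVdef, List.append_assoc, List.append_assoc, List.append_assoc, List.append_assoc,
        ← List.append_assoc A W, ← List.append_assoc A W]
      refine ((h1.append_right B).append_left (A ++ W)).trans ?_
      rw [List.append_assoc S, ← List.append_assoc (A ++ W) S, ← List.append_assoc S]
      exact List.perm_append_comm.append_right _
    rw [rightShift, Finset.mem_union, mem_sdiff_toFinset (nodup_of_pairwise_fst hL) hperm,
      List.mem_toFinset, List.mem_toFinset]
    simp only [List.mem_append, mem_rightBlocks, ← hSdef]
    tauto
  have hcolQ : (A ++ (W ++ rightBlocks b bs) ++ B).Pairwise fun s t => s.1 < t.1 := by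
    -- The old columns with `b` inserted after the window, strictly increasing because column `b` is
    -- empty; the shifted columns form a sublist.
    have h1 : ((A ++ V).map Prod.fst ++ b :: B.map Prod.fst).Pairwise (· < ·) := by
      have h2 := List.pairwise_append.1 hL
      refine List.pairwise_append.2 ⟨List.pairwise_map.2 h2.1,
        List.pairwise_cons.2 ⟨by simpa using fun x y h => hB (x, y) h,
          List.pairwise_map.2 h2.2.1⟩, ?_⟩
      intro x hx y hy
      obtain ⟨s, hs, rfl⟩ := List.mem_map.1 hx
      rcases List.mem_cons.1 hy with rfl | hy
      · have h3 := hempty s (List.mem_toFinset.2 (List.mem_append_left _ hs))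
        rcases List.mem_append.1 hs with hs | hs
        · have := hA s hs; omega
        · have := ((hV s).1 hs).2.2; omega
      · obtain ⟨t, ht, rfl⟩ := List.mem_map.1 hy
        exact h2.2.2 s hs t ht
    refine List.pairwise_map.1 (h1.sublist ?_)
    have h4 : (rightBlocks b bs).map Prod.fst |>.Sublist
        ((bs.flatMap fun p => p.1 :: p.2).map Prod.fst ++ [b]) := by
      rw [← map_fst_rightBlocks]
      exact List.sublist_cons_self _ _
    have h5 : (A ++ V).map Prod.fst ++ b :: B.map Prod.fst = (A ++ W).map Prod.fst ++
        ((bs.flatMap fun p => p.1 :: p.2).map Prod.fst ++ [b]) ++ B.map Prod.fst := by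
      simp [hVdef]
    rw [h5]
    simp only [List.map_append, ← List.append_assoc] at h4 ⊢
    exact (h4.append_left _).append_right _ |>.trans (by simp)
  have hrow : ∀ x ∈ V.map Prod.snd, ∃ s ∈ (A ++ V ++ B).toFinset, s.2 = x := by
    intro x hx
    obtain ⟨s, hs, rfl⟩ := List.mem_map.1 hx
    exact ⟨s, (hmem.1 hs).1, rfl⟩
  have hperm : ((W ++ bs.flatMap fun p => p.2 ++ [p.1]).map Prod.snd).Perm (V.map Prod.snd) := by
    rw [hVdef]
    exact (((perm_blocks_left bs).trans (perm_blocks_right bs).symm).append_left W).map _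
  have hfin := h.knuth (V.map Prod.snd) ((W ++ bs.flatMap fun p => p.2 ++ [p.1]).map Prod.snd)
    hrow (by
      have := hnodup
      rw [← Function.comp_def g Prod.snd, ← List.map_map] at this
      exact this.of_map _)
    (fun x hx => hrow x (hperm.subset hx)) (by simpa [Function.comp_def] using hK)
  rw [hQ, ins, ins, word_toFinset hL, word_toFinset hcolQ]
  have := (hfin.congr (A.map Prod.snd) (B.map Prod.snd)).foldl_tableauInsert
  simpa [map_snd_rightBlocks] using this

theorem ins_leftShift {P : Finset Square} {g : ℕ → ℕ} {a b : ℕ} {S : List Square}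
    (h : IsWindowChain P g a b S) (hab : a ≤ b) (hempty : EmptyColumn P a)
    (hlex : ∀ Z f F e E, S = Z ++ f :: F → (∀ s ∈ Z ++ e :: E, s ∈ P ∧ a ≤ s.1 ∧ s.1 ≤ b) →
      (Z ++ e :: E).Pairwise (Before fun s => g s.2) → E.length = F.length → g e.2 ≤ g f.2) :
    ins P = ins (leftShift P a S) := by
  obtain ⟨L, hL, rfl⟩ := exists_list_of_placement P h.col_inj
  obtain ⟨A, V, B, rfl, hA, hB, hV⟩ := exists_window L hL a b
  simp only [List.mem_toFinset] at h hlex hempty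
  have hVcol := (List.pairwise_append.1 (List.pairwise_append.1 hL).1).2.1
  have hmem : ∀ {s}, s ∈ V ↔ s ∈ (A ++ V ++ B).toFinset ∧ a ≤ s.1 ∧ s.1 ≤ b := by
    intro s; rw [List.mem_toFinset]; exact hV s
  have hsub : S.Sublist V :=
    sublist_of_subset (h.chain.imp fun h => h.1) hVcol fun s hs => hmem.2 (h.mem s hs)
  obtain ⟨W, bs, hVdef, hSdef⟩ := exists_blocks_left hsub
  have hnodup : (V.map fun s => g s.2).Nodup :=
    List.Nodup.map_on (fun s hs t ht => h.inj s (hmem.1 hs).1 t (hmem.1 ht).1)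
      (nodup_of_pairwise_fst hVcol)
  have hK := knuth_of_largest (ρ := fun s => g s.2) W bs hVdef hSdef hVcol hnodup
    ⟨fun s hs => hmem.2 (h.mem s hs), h.chain⟩
    (fun T hT => h.longest T (fun s hs => hmem.1 (hT.1 s hs)) hT.2)
    (fun Z f F e E hZ hE hlen => hlex Z f F e E hZ (fun s hs => (hV s).1 (hE.1 s hs)) hE.2 hlen)
  have hQ : leftShift (A ++ V ++ B).toFinset a S =
      (A ++ (leftBlocks a bs ++ W) ++ B).toFinset := by
    ext x
    have hperm : (A ++ V ++ B).Perm (S ++ (A ++ (bs.flatMap Prod.snd ++ W) ++ B)) := by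
      have h1 := perm_blocks_left bs
      rw [← hSdef] at h1
      rw [hVdef, List.append_assoc, List.append_assoc, List.append_assoc, List.append_assoc]
      refine ((h1.append_right (W ++ B)).append_left A).trans ?_
      rw [List.append_assoc S, ← List.append_assoc A S, ← List.append_assoc S]
      exact List.perm_append_comm.append_right _
    rw [leftShift, Finset.mem_union, mem_sdiff_toFinset (nodup_of_pairwise_fst hL) hperm,
      List.mem_toFinset, List.mem_toFinset]
    simp only [List.mem_append, mem_leftBlocks, ← hSdef]
    tauto
  have hcolQ : (A ++ (leftBlocks a bs ++ W) ++ B).Pairwise fun s t => s.1 < t.1 := by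
    -- For a left shift the empty column `a` is inserted before the window.
    have h1 : (A.map Prod.fst ++ a :: (V ++ B).map Prod.fst).Pairwise (· < ·) := by
      have h2 := List.pairwise_append.1 (by simpa using hL :
        (A ++ (V ++ B)).Pairwise fun s t => s.1 < t.1)
      refine List.pairwise_append.2 ⟨List.pairwise_map.2 h2.1,
        List.pairwise_cons.2 ⟨?_, List.pairwise_map.2 h2.2.1⟩, ?_⟩
      · intro x hx
        obtain ⟨s, hs, rfl⟩ := List.mem_map.1 hx
        have h3 := hempty s (List.mem_toFinset.2 (by
          simp only [List.mem_append] at hs ⊢; tauto))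
        rcases List.mem_append.1 hs with hs | hs
        · have := ((hV s).1 hs).2.1; omega
        · have := hB s hs; omega
      · intro x hx y hy
        obtain ⟨s, hs, rfl⟩ := List.mem_map.1 hx
        rcases List.mem_cons.1 hy with rfl | hy
        · exact hA s hs
        · obtain ⟨t, ht, rfl⟩ := List.mem_map.1 hy
          exact h2.2.2 s hs t ht
    refine List.pairwise_map.1 (h1.sublist ?_)
    have h4 := map_fst_leftBlocks bs a
    have h5 : A.map Prod.fst ++ a :: (V ++ B).map Prod.fst = A.map Prod.fst ++
        ((a :: (bs.flatMap fun p => p.2 ++ [p.1]).map Prod.fst) ++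
          (W.map Prod.fst ++ B.map Prod.fst)) := by
      simp [hVdef]
    rw [h5]
    simp only [List.map_append, List.append_assoc]
    exact (h4.append_right _).append_left _
  have hrow : ∀ x ∈ V.map Prod.snd, ∃ s ∈ (A ++ V ++ B).toFinset, s.2 = x := by
    intro x hx
    obtain ⟨s, hs, rfl⟩ := List.mem_map.1 hx
    exact ⟨s, (hmem.1 hs).1, rfl⟩
  have hperm : (((bs.flatMap fun p => p.1 :: p.2) ++ W).map Prod.snd).Perm (V.map Prod.snd) := by
    rw [hVdef]
    exact (((perm_blocks_right bs).trans (perm_blocks_left bs).symm).append_right W).map _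
  have hfin := h.knuth (V.map Prod.snd) (((bs.flatMap fun p => p.1 :: p.2) ++ W).map Prod.snd)
    hrow (by
      have := hnodup
      rw [← Function.comp_def g Prod.snd, ← List.map_map] at this
      exact this.of_map _)
    (fun x hx => hrow x (hperm.subset hx)) (by simpa [Function.comp_def] using hK)
  rw [hQ, ins, ins, word_toFinset hL, word_toFinset hcolQ]
  have := (hfin.congr (A.map Prod.snd) (B.map Prod.snd)).foldl_tableauInsert
  simpa [map_snd_leftBlocks] using this

/-! ### Generalized Knuth transformations -/

theorem le_of_append_le {m n : ℕ} {u v : List ℕ} (z : List ℕ)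
    (h : z ++ m :: u ≤ z ++ n :: v) : m ≤ n := by
  by_contra hlt
  refine absurd h (not_le.2 ?_)
  clear h
  induction z with
  | nil => exact List.Lex.rel (not_le.1 hlt)
  | cons x z ih => exact List.Lex.cons ih

variable {p q : ℕ}

theorem RookPlacement.row_le (P : RookPlacement (rectBoard p q)) {s : Square}
    (hs : s ∈ P.squares) : s.2 ≤ q :=
  (Finset.mem_Icc.1 (Finset.mem_product.1 (P.subset hs)).2).2

theorem isWindowChain_of_inc (P : RookPlacement (rectBoard p q)) {a b : ℕ} {S : List Square}
    (hS : IsLongest (IsIncSeq P.squares a b) S) :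
    IsWindowChain P.squares (fun r => r) a b S where
  mem := hS.1.1
  chain := hS.1.2
  longest T hT hT' := hS.2 T ⟨hT, hT'⟩
  col_inj := P.col_inj
  inj := P.row_inj
  knuth v w _ _ _ h := by simpa using h

theorem isDecSeq_iff (P : RookPlacement (rectBoard p q)) {a b : ℕ} {T : List Square} :
    IsDecSeq P.squares a b T ↔ (∀ s ∈ T, s ∈ P.squares ∧ a ≤ s.1 ∧ s.1 ≤ b) ∧
      T.Pairwise (Before fun s => q - s.2) := by
  refine and_congr_right fun hT => ⟨fun h => ?_, fun h => ?_⟩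
  · refine h.imp_of_mem fun {s t} hs ht h => ⟨h.1, ?_⟩
    have h1 := P.row_le (hT s hs).1
    have h2 := h.2
    simp only; omega
  · refine h.imp_of_mem fun {s t} hs ht h => ⟨h.1, ?_⟩
    have h1 := P.row_le (hT s hs).1
    have h2 := h.2
    simp only at h2; omega

/-- On rows at most `q` the map `r ↦ q - r` is injective and its own inverse, so complementing once
more carries a Knuth equivalence of complemented words back. -/
theorem isWindowChain_of_dec (P : RookPlacement (rectBoard p q)) {a b : ℕ} {S : List Square}
    (hS : IsLongest (IsDecSeq P.squares a b) S) :
    IsWindowChain P.squares (fun r => q - r) a b S where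
  mem := hS.1.1
  chain := ((isDecSeq_iff P).1 hS.1).2
  longest T hT hT' := hS.2 T ((isDecSeq_iff P).2 ⟨hT, hT'⟩)
  col_inj := P.col_inj
  inj s hs t ht h := P.row_inj s hs t ht (by
    have := P.row_le hs
    have := P.row_le ht
    omega)
  knuth v w hv hn hw h := by
    have hle : ∀ u : List ℕ, (∀ x ∈ u, ∃ s ∈ P.squares, s.2 = x) →
        (u.map (q - ·)).map (q - ·) = u := by
      intro u hu
      rw [List.map_map]
      conv_rhs => rw [← List.map_id u]
      refine List.map_congr_left fun x hx => ?_
      obtain ⟨s, hs, rfl⟩ := hu x hx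
      have := P.row_le hs
      simp only [Function.comp_apply, id_eq]; omega
    have := h.map_sub q (List.Nodup.map_on (fun x hx y hy hxy => by
      obtain ⟨s, hs, rfl⟩ := hv x hx
      obtain ⟨t, ht, rfl⟩ := hv y hy
      have := P.row_le hs
      have := P.row_le ht
      omega) hn) (by simp)
    rwa [hle v hv, hle w hw] at this

/-- The complement reverses the lexicographic comparison, so the decreasing cases need the same
extremality as the increasing ones: largest for left shifts, smallest for right shifts. -/
theorem ins_eq_of_genKnuthStep {P Q : RookPlacement (rectBoard p q)} (h : GenKnuthStep P Q) :
    ins P.squares = ins Q.squares := by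
  have hlen : ∀ {S Z F E : List Square} {f e : Square}, S = Z ++ f :: F → E.length = F.length →
      S.length ≤ (Z ++ e :: E).length := by
    rintro S Z F E f e rfl h; simp [h]
  cases h with
  | leftDec a b S ha hab hb hcol hS hQ =>
    rw [hQ]
    refine ins_leftShift (isWindowChain_of_dec P hS.1) hab.le hcol ?_
    intro Z f F e E hZ hE hE' hl
    have h1 := (isDecSeq_iff P).2 ⟨hE, hE'⟩
    -- A sequence of the length of `S` is itself longest, so the extremality of `S` applies to it.
    have h2 := hS.2 _ ⟨h1, fun T hT => (hS.1.2 T hT).trans (hlen hZ hl)⟩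
    rw [hZ] at h2
    have := le_of_append_le (Z.map Prod.snd) (by simpa using h2)
    omega
  | leftInc a b S ha hab hb hcol hS hQ =>
    rw [hQ]
    refine ins_leftShift (isWindowChain_of_inc P hS.1) hab.le hcol ?_
    intro Z f F e E hZ hE hE' hl
    have h2 := hS.2 _ ⟨⟨hE, hE'⟩, fun T hT => (hS.1.2 T hT).trans (hlen hZ hl)⟩
    rw [hZ] at h2
    exact le_of_append_le (Z.map Prod.snd) (by simpa using h2)
  | rightDec a b S ha hab hb hcol hS hQ =>
    rw [hQ]
    refine ins_rightShift (isWindowChain_of_dec P hS.1) hab.le hcol ?_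
    intro Z f F e E hZ hE hE' hl
    have h1 := (isDecSeq_iff P).2 ⟨hE, hE'⟩
    have h2 := hS.2 _ ⟨h1, fun T hT => (hS.1.2 T hT).trans (hlen hZ hl)⟩
    rw [hZ] at h2
    have := le_of_append_le (Z.map Prod.snd) (by simpa using h2)
    omega
  | rightInc a b S ha hab hb hcol hS hQ =>
    rw [hQ]
    refine ins_rightShift (isWindowChain_of_inc P hS.1) hab.le hcol ?_
    intro Z f F e E hZ hE hE' hl
    have h2 := hS.2 _ ⟨⟨hE, hE'⟩, fun T hT => (hS.1.2 T hT).trans (hlen hZ hl)⟩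
    rw [hZ] at h2
    exact le_of_append_le (Z.map Prod.snd) (by simpa using h2)

end GenKnuth

theorem mainTheorem7 {p q : ℕ} (P Q : GenKnuth.RookPlacement (GenKnuth.rectBoard p q))
    (h : GenKnuth.DifferByGenKnuth P Q) :
    GenKnuth.ins P.squares = GenKnuth.ins Q.squares := by
  induction h with
  | rel P Q h => exact GenKnuth.ins_eq_of_genKnuthStep h
  | refl P => rfl
  | symm P Q _ ih => exact ih.symm
  | trans P Q R _ _ ih ih' => exact ih.trans ih'
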